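/- **Theorem (Termination and Deadlock Freedom).** Let $R$ be an $\mathsf{SMLL}$ net (in particular, $R$ may be an $\mathsf{SMLL}^0$ net, i.e. a net without unit links and boxes), and let $M_R$ be its multitoken machine. Then all runs of $M_R$ are finite and end in a final state; moreover, all runs end in one and the same final state $\mathbf F_R$. *Nets.* Formulas are $A ::= 1 \mid \bot \mid X \mid X^\bot \mid A\otimes A \mid A \wp A$ (the last connective is par) with the usual linear negation; positive formulas are $P::=1\mid P\otimes P$, negative ones $N::=\bot\mid N \wp N$. A structure is a finite directed multigraph with edges typed by formulas; each edge has exactly one source link (of which it is a conclusion) and at most one target link (of which it is a premiss). The links are: $\mathsf{ax}$ (conclusions $A,A^\bot$), $\mathsf{cut}$ (premisses $A,A^\bot$), $\otimes$ and $\wp$ (premisses $A,B$, conclusion $A\otimes B$, resp. $A \wp B$), $\mathsf{one}$ (conclusion $1$), sync links ($n\ge 1$ premisses and $n$ corresponding conclusions, the $i$-th premiss and the $i$-th conclusion having the same positive or negative type), and boxes: a box of conclusions $\bot,\Gamma$ contains a structure of conclusions $\Gamma$; its conclusion $\bot$ is its lock. The pending edges at depth $0$ are the conclusions of the structure. The in-edges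 of a sync link are its positive premisses and negative conclusions, its out-edges are its positive conclusions and negative premisses. A structure is correct (a net) if its $0$-graph (its links of depth $0$, each box being one node with the conclusions of the box and without premisses) has no switching cycle, i.e. no undirected simple cycle that uses at most one premiss of each $\wp$ link and at most one out-edge of each sync link, and if the content of each box is correct. *Positions.* The positions are the pairs $(e,m)$ with $e$ an edge and $m\in\{\mathbf l,\mathbf r\}^*$ the address of an occurrence of an atom in the type of $e$ (positive for $1,X$, negative for $\bot,X^\bot$), and the pairs $(e,i)$ with $e$ the lock of a box and $i\in\mathbb N$. $\mathtt{INIT}$ (resp. $\mathtt{FIN}$) is the set of negative (resp. positive) occurrences of atoms in the conclusions of $R$; $\mathtt{ONES}$ is the set of occurrences of $1$ that are conclusions of $\mathsf{one}$ links; $\mathtt{BOTBOX}$ is the set of the pairs $(e,i)$ with $e$ a lock. *Machine.* A state is a function $\mathbf T:\mathtt{INIT}\cup S\to\mathtt{POS}(R)$ with $S\subseteq\mathtt{ONES}$; the initial state $\mathbf I_R$ is the identity on $\mathtt{INIT}$; a state is final if its image is $\mathtt{FIN}\cup B$ for some $B\subseteq\mathtt{BOTBOX}$. A box with lock $e$ is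 unlocked if some $(e,i)$ is in the image of $\mathbf T$. In a transition either one token moves, where a token on a negative position moves upwards and one on a positive position moves downwards: across an axiom or a cut, from $(e,m)$ to $(f,m)$ with $f$ the other edge of the link; across a $\otimes$ or $\wp$ link, between $m$ on the left (right) premiss and $\mathbf l m$ ($\mathbf r m$) on the conclusion; on the lock $e$ of a box, from $(e,\varepsilon)$ to $(e,0)$; across the border of an unlocked box, between the corresponding edges of $\Gamma$ inside and outside. Or, for a sync link all of whose in-edges are saturated (every atom occurrence carries a token), all tokens on the in-edges cross the link simultaneously to the corresponding edges. Or, for a $\mathsf{one}$ link with conclusion $e$ that is active (at depth $0$, or at depth $0$ inside an unlocked box) and with $(e,\varepsilon)\notin\mathrm{dom}(\mathbf T)$, the domain is extended by $(e,\varepsilon)\mapsto(e,\varepsilon)$. A run is a maximal (finite or infinite) sequence of transitions that starts in $\mathbf I_R$. -/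

import Mathlib

namespace SMLL

/-- Formulas of multiplicative linear logic with units; `covar n` is the negation of `var n`. -/
inductive Formula : Type
  | one : Formula
  | bot : Formula
  | var (n : ℕ) : Formula
  | covar (n : ℕ) : Formula
  | tensor (A B : Formula) : Formula
  | par (A B : Formula) : Formula

namespace Formula

/-- Linear negation. -/
def dual : Formula → Formula
  | one => bot
  | bot => one
  | var n => covar n
  | covar n => var n
  | tensor A B => par A.dual B.dual
  | par A B => tensor A.dual B.dual

theorem dual_dual (A : Formula) : A.dual.dual = A := by
  induction A <;> simp_all [dual]

/-- Positive formulas `P ::= 1 | P ⊗ P`. -/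
def IsPositive : Formula → Prop
  | one => True
  | tensor A B => A.IsPositive ∧ B.IsPositive
  | _ => False

/-- Negative formulas `N ::= ⊥ | N ⅋ N`. -/
def IsNegative : Formula → Prop
  | bot => True
  | par A B => A.IsNegative ∧ B.IsNegative
  | _ => False

end Formula

/-- The letters of addresses. -/
inductive Dir : Type
  | left : Dir
  | right : Dir

namespace Formula

/-- `A.PosOcc m`: `m` is the address in `A` of an occurrence of a positive atom (`1` or `X`). -/
def PosOcc : Formula → List Dir → Prop
  | one, [] => True
  | var _, [] => True
  | tensor A _, Dir.left :: m => A.PosOcc m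
  | tensor _ B, Dir.right :: m => B.PosOcc m
  | par A _, Dir.left :: m => A.PosOcc m
  | par _ B, Dir.right :: m => B.PosOcc m
  | _, _ => False

/-- `A.NegOcc m`: `m` is the address in `A` of an occurrence of a negative atom (`⊥` or the
negation of a variable). -/
def NegOcc : Formula → List Dir → Prop
  | bot, [] => True
  | covar _, [] => True
  | tensor A _, Dir.left :: m => A.NegOcc m
  | tensor _ B, Dir.right :: m => B.NegOcc m
  | par A _, Dir.left :: m => A.NegOcc m
  | par _ B, Dir.right :: m => B.NegOcc m
  | _, _ => False

/-- `A.Occ m`: `m` is the address in `A` of an occurrence of an atom. -/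
def Occ (A : Formula) (m : List Dir) : Prop :=
  A.PosOcc m ∨ A.NegOcc m

end Formula

/-- The links, with the edges of type `E` attached to them.

* `ax e f` has the conclusions `e`, `f`;
* `cut e f` has the premisses `e`, `f`;
* `tensor a b c` and `par a b c` have the premisses `a`, `b` (left, right) and the conclusion `c`;
* `one e` has the conclusion `e`;
* `sync ps` has, for every pair `(a, c)` in `ps`, a premiss `a` with corresponding conclusion `c`;
* `box e ds` is a `bot` link together with its box: `e` is the lock, and for every pair `(d, c)` in
  `ds`, `c` is an auxiliary conclusion of the box, and `d` is the corresponding conclusion of the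
  structure contained in the box. -/
inductive Link (E : Type) : Type
  | ax (e f : E) : Link E
  | cut (e f : E) : Link E
  | tensor (a b c : E) : Link E
  | par (a b c : E) : Link E
  | one (e : E) : Link E
  | sync (ps : List (E × E)) : Link E
  | box (lock : E) (doors : List (E × E)) : Link E

namespace Link

variable {E : Type}

/-- The premisses of a link; a box has none. -/
def premisses : Link E → List E
  | ax _ _ => []
  | cut e f => [e, f]
  | tensor a b _ => [a, b]
  | par a b _ => [a, b]
  | one _ => []
  | sync ps => ps.map Prod.fst
  | box _ _ => []

/-- The conclusions of a link; those of a box are its lock and its auxiliary conclusions. -/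
def conclusions : Link E → List E
  | ax e f => [e, f]
  | cut _ _ => []
  | tensor _ _ c => [c]
  | par _ _ c => [c]
  | one e => [e]
  | sync ps => ps.map Prod.snd
  | box e ds => e :: ds.map Prod.snd

/-- The conclusions of the content of a box. -/
def inner : Link E → List E
  | box _ ds => ds.map Prod.fst
  | _ => []

/-- The link is a box. -/
def IsBox (k : Link E) : Prop :=
  ∃ e ds, k = box e ds

/-- The constraints on the types of the premisses and conclusions. -/
def WellTyped (ty : E → Formula) : Link E → Prop
  | ax e f => ty f = (ty e).dual
  | cut e f => ty f = (ty e).dual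
  | tensor a b c => ty c = Formula.tensor (ty a) (ty b)
  | par a b c => ty c = Formula.par (ty a) (ty b)
  | one e => ty e = Formula.one
  | sync ps => ps ≠ [] ∧
      ∀ p ∈ ps, ty p.1 = ty p.2 ∧ ((ty p.1).IsPositive ∨ (ty p.1).IsNegative)
  | box e ds => ty e = Formula.bot ∧ ∀ d ∈ ds, ty d.1 = ty d.2

/-- The in-edges of a sync link: positive premisses and negative conclusions. -/
def InEdge (ty : E → Formula) (ps : List (E × E)) (e : E) : Prop :=
  ∃ p ∈ ps, ((ty p.1).IsPositive ∧ e = p.1) ∨ ((ty p.2).IsNegative ∧ e = p.2)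

/-- The out-edges of a sync link: positive conclusions and negative premisses. -/
def OutEdge (ty : E → Formula) (ps : List (E × E)) (e : E) : Prop :=
  ∃ p ∈ ps, ((ty p.2).IsPositive ∧ e = p.2) ∨ ((ty p.1).IsNegative ∧ e = p.1)

end Link

/-- Structures with boxes, with links `L` and edges `E`. `boxOf l` is the innermost box to which
`l` belongs (`none` if `l` has depth `0`); so the content of a box `b` consists of all links from
which `b` is reached by iterating `boxOf`, and any two boxes are disjoint or nested. A box counts as
a link of the structure in which it lies, not of its own content. -/
structure Structure (L E : Type) : Type where
  ty : E → Formula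
  link : L → Link E
  boxOf : L → Option L
  wellTyped : ∀ l, (link l).WellTyped ty
  /-- Every edge has exactly one source. -/
  source : ∀ e, ∃! l, e ∈ (link l).conclusions
  conclusions_nodup : ∀ l, (link l).conclusions.Nodup
  /-- Every edge has at most one target. -/
  target : ∀ e l l', e ∈ (link l).premisses → e ∈ (link l').premisses → l = l'
  premisses_nodup : ∀ l, (link l).premisses.Nodup
  boxOf_isBox : ∀ l b, boxOf l = some b → (link b).IsBox
  /-- No box belongs to itself. -/
  boxOf_acyclic : ∀ l, ¬ Relation.TransGen (fun k b => boxOf k = some b) l l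
  /-- Edges do not connect a link inside a box with a link outside of it. -/
  premiss_level : ∀ e l l', e ∈ (link l).conclusions → e ∈ (link l').premisses →
    boxOf l = boxOf l'
  inner_nodup : ∀ b, (link b).inner.Nodup
  /-- The conclusions of the content of `b` are the edges of the content at depth `0` that have no
  target. -/
  inner_iff : ∀ b e, e ∈ (link b).inner ↔
    (∃ l, boxOf l = some b ∧ e ∈ (link l).conclusions) ∧ ∀ l, e ∉ (link l).premisses

namespace Structure

variable {L E : Type} (R : Structure L E)

/-- The conclusions of the structure: the pending edges at depth `0`. -/
def IsConclusion (e : E) : Prop :=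
  (∃ l, R.boxOf l = none ∧ e ∈ (R.link l).conclusions) ∧ ∀ l, e ∉ (R.link l).premisses

/-! ### Correctness -/

/-- The edge `e` connects the links `l` and `l'` (in either direction). -/
def Joins (e : E) (l l' : L) : Prop :=
  (e ∈ (R.link l).conclusions ∧ e ∈ (R.link l').premisses) ∨
    (e ∈ (R.link l').conclusions ∧ e ∈ (R.link l).premisses)

/-- A cyclic switching path in the `0`-graph of the content of the box `b` (if `r = some b`) or of
the whole structure (if `r = none`): it visits pairwise different links
`v 0, v 1, …, v n, v 0`, all at depth `0` in that structure, along pairwise different edges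
`d 0, …, d n`, and uses at most one of the premisses of each `par` link and at most one of
the out-edges of each sync link. Addition in `Fin (n + 1)` is cyclic. -/
structure IsSwitchingCycle (r : Option L) (n : ℕ) (v : Fin (n + 1) → L) (d : Fin (n + 1) → E) :
    Prop where
  level : ∀ i, R.boxOf (v i) = r
  links_injective : Function.Injective v
  edges_injective : Function.Injective d
  joins : ∀ i, R.Joins (d i) (v i) (v (i + 1))
  par : ∀ l a b c, R.link l = Link.par a b c → ¬ (a ∈ Set.range d ∧ b ∈ Set.range d)
  sync : ∀ l ps, R.link l = Link.sync ps → ∀ o o', Link.OutEdge R.ty ps o →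
    Link.OutEdge R.ty ps o' → o ∈ Set.range d → o' ∈ Set.range d → o = o'

/-- A structure is correct, that is, a net, if there is no switching cycle in its `0`-graph nor in
the `0`-graph of the content of any of its boxes. -/
def IsNet : Prop :=
  ∀ r n v d, ¬ R.IsSwitchingCycle r n v d

end Structure

/-! ### The multitoken machine -/

/-- Candidates for positions: `atom e m` is the pair of an edge and an address, `lock e i` is the
pair of an edge and a natural number. -/
inductive Pos (E : Type) : Type
  | atom (e : E) (m : List Dir) : Pos E
  | lock (e : E) (i : ℕ) : Pos E

namespace Structure

variable {L E : Type} (R : Structure L E)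

/-- `e` is the lock of a box. -/
def IsLock (e : E) : Prop :=
  ∃ b ds, R.link b = Link.box e ds

/-- The positions of `R`. -/
def POS : Set (Pos E) :=
  {p | (∃ e m, (R.ty e).Occ m ∧ p = Pos.atom e m) ∨ ∃ e i, R.IsLock e ∧ p = Pos.lock e i}

/-- Initial positions: negative occurrences of atoms in the conclusions of `R`. -/
def INIT : Set (Pos E) :=
  {p | ∃ e m, R.IsConclusion e ∧ (R.ty e).NegOcc m ∧ p = Pos.atom e m}

/-- Final positions: positive occurrences of atoms in the conclusions of `R`. -/
def FIN : Set (Pos E) :=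
  {p | ∃ e m, R.IsConclusion e ∧ (R.ty e).PosOcc m ∧ p = Pos.atom e m}

/-- The occurrences of `1` that are conclusions of `one` links. -/
def ONES : Set (Pos E) :=
  {p | ∃ l e, R.link l = Link.one e ∧ p = Pos.atom e []}

/-- The positions `(e, i)` with `e` the lock of a box. -/
def BOTBOX : Set (Pos E) :=
  {p | ∃ e i, R.IsLock e ∧ p = Pos.lock e i}

/-- States: functions from `INIT ∪ S` to `POS`, for some `S ⊆ ONES`, given as partial functions.
`T.tok s = some p` says that the token of origin `s` is on the position `p`. -/
structure State : Type where
  tok : Pos E → Option (Pos E)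
  dom : ∃ S, S ⊆ R.ONES ∧ ∀ s, (∃ p, tok s = some p) ↔ s ∈ R.INIT ∪ S
  pos : ∀ s p, tok s = some p → p ∈ R.POS

open Classical in
/-- The initial state: the identity on `INIT`. -/
noncomputable def initialState : R.State where
  tok s := if s ∈ R.INIT then some s else none
  dom := ⟨∅, Set.empty_subset _, fun s => by by_cases h : s ∈ R.INIT <;> simp [h]⟩
  pos s p h := by
    by_cases hs : s ∈ R.INIT
    · rw [if_pos hs] at h
      cases h
      obtain ⟨e, m, _, hm, rfl⟩ := hs
      exact Or.inl ⟨e, m, Or.inr hm, rfl⟩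
    · rw [if_neg hs] at h
      cases h

variable {R}

namespace State

/-- The image of the state: the positions on which there is a token. -/
def image (T : R.State) : Set (Pos E) :=
  {p | ∃ s, T.tok s = some p}

/-- Final states. -/
def IsFinal (T : R.State) : Prop :=
  ∃ B, B ⊆ R.BOTBOX ∧ T.image = R.FIN ∪ B

/-- There is a token on every position of the edge `e`. -/
def Saturated (T : R.State) (e : E) : Prop :=
  ∀ m, (R.ty e).Occ m → Pos.atom e m ∈ T.image

/-- The box `b` is unlocked. -/
def Unlocked (T : R.State) (b : L) : Prop :=
  ∃ e ds i, R.link b = Link.box e ds ∧ Pos.lock e i ∈ T.image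

/-- The link `l` is active: it is at depth `0`, or at depth `0` inside an unlocked box. -/
def Active (T : R.State) (l : L) : Prop :=
  R.boxOf l = none ∨ ∃ b, R.boxOf l = some b ∧ T.Unlocked b

/-- The moves of one single token from a position to another one, in the state `T`. -/
inductive Move (T : R.State) : Pos E → Pos E → Prop
  | ax_left (l : L) (e f : E) (m : List Dir) : R.link l = Link.ax e f → (R.ty e).NegOcc m →
      Move T (Pos.atom e m) (Pos.atom f m)
  | ax_right (l : L) (e f : E) (m : List Dir) : R.link l = Link.ax e f → (R.ty f).NegOcc m →
      Move T (Pos.atom f m) (Pos.atom e m)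
  | cut_left (l : L) (e f : E) (m : List Dir) : R.link l = Link.cut e f → (R.ty e).PosOcc m →
      Move T (Pos.atom e m) (Pos.atom f m)
  | cut_right (l : L) (e f : E) (m : List Dir) : R.link l = Link.cut e f → (R.ty f).PosOcc m →
      Move T (Pos.atom f m) (Pos.atom e m)
  | down_left (l : L) (a b c : E) (m : List Dir) :
      R.link l = Link.tensor a b c ∨ R.link l = Link.par a b c → (R.ty a).PosOcc m →
      Move T (Pos.atom a m) (Pos.atom c (Dir.left :: m))
  | down_right (l : L) (a b c : E) (m : List Dir) :
      R.link l = Link.tensor a b c ∨ R.link l = Link.par a b c → (R.ty b).PosOcc m →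
      Move T (Pos.atom b m) (Pos.atom c (Dir.right :: m))
  | up_left (l : L) (a b c : E) (m : List Dir) :
      R.link l = Link.tensor a b c ∨ R.link l = Link.par a b c →
      (R.ty c).NegOcc (Dir.left :: m) →
      Move T (Pos.atom c (Dir.left :: m)) (Pos.atom a m)
  | up_right (l : L) (a b c : E) (m : List Dir) :
      R.link l = Link.tensor a b c ∨ R.link l = Link.par a b c →
      (R.ty c).NegOcc (Dir.right :: m) →
      Move T (Pos.atom c (Dir.right :: m)) (Pos.atom b m)
  | unlock (b : L) (e : E) (ds : List (E × E)) : R.link b = Link.box e ds →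
      Move T (Pos.atom e []) (Pos.lock e 0)
  | exit_box (b : L) (e : E) (ds : List (E × E)) (d c : E) (m : List Dir) :
      R.link b = Link.box e ds → (d, c) ∈ ds → T.Unlocked b → (R.ty d).PosOcc m →
      Move T (Pos.atom d m) (Pos.atom c m)
  | enter_box (b : L) (e : E) (ds : List (E × E)) (d c : E) (m : List Dir) :
      R.link b = Link.box e ds → (d, c) ∈ ds → T.Unlocked b → (R.ty c).NegOcc m →
      Move T (Pos.atom c m) (Pos.atom d m)

/-- How a token on an in-edge crosses a sync link, to the corresponding out-edge. -/
inductive Cross (R : Structure L E) (ps : List (E × E)) : Pos E → Pos E → Prop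
  | down (a c : E) (m : List Dir) : (a, c) ∈ ps → (R.ty a).PosOcc m →
      Cross R ps (Pos.atom a m) (Pos.atom c m)
  | up (a c : E) (m : List Dir) : (a, c) ∈ ps → (R.ty c).NegOcc m →
      Cross R ps (Pos.atom c m) (Pos.atom a m)

/-- The transition relation of the machine. -/
inductive Step (T U : R.State) : Prop
  /-- One token moves, all others stay. -/
  | move (s p q : Pos E) : T.tok s = some p → T.Move p q → U.tok s = some q →
      (∀ t, t ≠ s → U.tok t = T.tok t) → Step T U
  /-- If all in-edges of a sync link are saturated, all tokens on them cross simultaneously. -/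
  | sync (l : L) (ps : List (E × E)) : R.link l = Link.sync ps →
      (∀ e, Link.InEdge R.ty ps e → T.Saturated e) →
      (∀ t p q, T.tok t = some p → Cross R ps p q → U.tok t = some q) →
      (∀ t, (∀ p q, T.tok t = some p → ¬ Cross R ps p q) → U.tok t = T.tok t) → Step T U
  /-- A new token appears on the conclusion of an active `one` link. -/
  | one (l : L) (e : E) : R.link l = Link.one e → T.Active l →
      T.tok (Pos.atom e []) = none → U.tok (Pos.atom e []) = some (Pos.atom e []) →
      (∀ t, t ≠ Pos.atom e [] → U.tok t = T.tok t) → Step T U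

end State

variable (R)

/-- Runs: maximal sequences `τ 0 ⟶ τ 1 ⟶ ⋯` of transitions from the initial state. `N` is the
number of transitions, `⊤` for an infinite run; values of `τ` beyond `N` are irrelevant. -/
structure IsRun (N : ℕ∞) (τ : ℕ → R.State) : Prop where
  start : τ 0 = R.initialState
  step : ∀ n : ℕ, (n : ℕ∞) < N → State.Step (τ n) (τ (n + 1))
  maximal : ∀ n : ℕ, N = n → ∀ U, ¬ State.Step (τ n) U

end Structure

end SMLL

/-!
The machine is parallel, but the path of a single token is not: the next position of a token is
determined by its position, and so is the previous one. Hence the tokens follow disjoint paths that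
start at their origins, and every transition enlarges the set of visited positions. This set is
contained in a finite set, so that all runs are finite. If in a stuck state all positions on the
edges have been visited, then every token stands at the end of its path, which depends on its origin
only, and the state is final.

It remains to show that no position is left out. Let `T` be stuck, and blame the unvisited positions
of each edge on the source or on the target of the edge, whichever the tokens should have come from.
In a stuck state, a link that is blamed on one of its edges can pass the blame on to the other end
of another edge, in the manner of a switching path. In a finite net a blame that is passed on in
this way would trace out a switching cycle. A box cannot be entered while its lock is not visited,
so the argument is carried out box by box.
-/

namespace SMLL

/-! ### Orbits and chains of relations -/

section Relations

variable {α : Type*} {r : α → α → Prop}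

theorem exists_mem_periodicPts [Finite α] (f : α → α) (a : α) :
    ∃ x, x ∈ Function.periodicPts f := by
  obtain ⟨m, k, hmk, h⟩ := Finite.exists_ne_map_eq_of_infinite fun n : ℕ => f^[n] a
  wlog hlt : m < k generalizing m k
  · exact this k m hmk.symm h.symm (lt_of_le_of_ne (not_lt.1 hlt) hmk.symm)
  refine ⟨f^[m] a, Function.mk_mem_periodicPts (Nat.sub_pos_of_lt hlt) ?_⟩
  rw [Function.IsPeriodicPt, Function.IsFixedPt, ← Function.iterate_add_apply,
    Nat.sub_add_cancel hlt.le]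
  exact h.symm

theorem exists_injective_cycle [Finite α] [Nonempty α] (f : α → α) :
    ∃ (n : ℕ) (v : Fin (n + 1) → α), Function.Injective v ∧ ∀ i, v (i + 1) = f (v i) := by
  obtain ⟨x, hx⟩ := exists_mem_periodicPts f (Classical.arbitrary α)
  have hpos := Function.minimalPeriod_pos_of_mem_periodicPts hx
  obtain ⟨n, hn⟩ := Nat.exists_eq_succ_of_ne_zero hpos.ne'
  refine ⟨n, fun i => f^[i] x, fun i j hij => ?_, fun i => ?_⟩
  · refine Fin.ext (Function.iterate_injOn_Iio_minimalPeriod ?_ ?_ hij) <;>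
      simpa [hn] using Nat.lt_succ_iff.1 (Fin.is_lt _)
  · have hval : ((i + 1 : Fin (n + 1)) : ℕ) = (i + 1) % Function.minimalPeriod f x := by
      rw [hn, Fin.val_add]; simp
    simp only [hval]
    rw [Function.iterate_mod_minimalPeriod_eq, Function.iterate_succ_apply']

theorem wellFounded_of_forall_not_transGen [Finite α] (h : ∀ a, ¬ Relation.TransGen r a a) :
    WellFounded r :=
  have : Std.Irrefl (Relation.TransGen r) := ⟨h⟩
  (Finite.wellFounded_of_trans_of_irrefl (Relation.TransGen r)).mono
    fun _ _ => Relation.TransGen.single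

theorem eq_of_reflTransGen_of_terminal (hr : Relator.RightUnique r) {a b c : α}
    (hb : Relation.ReflTransGen r a b) (hc : Relation.ReflTransGen r a c)
    (hb' : ∀ x, ¬ r b x) (hc' : ∀ x, ¬ r c x) : b = c := by
  rcases hb.total_of_right_unique hr hc with h | h
  · exact (h.cases_head.resolve_right fun ⟨x, hx, _⟩ => hb' x hx)
  · exact (h.cases_head.resolve_right fun ⟨x, hx, _⟩ => hc' x hx).symm

theorem eq_of_reflTransGen_of_initial (hr : Relator.LeftUnique r) {a b c : α}
    (ha : Relation.ReflTransGen r a c) (hb : Relation.ReflTransGen r b c)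
    (ha' : ∀ x, ¬ r x a) (hb' : ∀ x, ¬ r x b) : a = b :=
  eq_of_reflTransGen_of_terminal hr.flip (Relation.reflTransGen_swap.2 ha)
    (Relation.reflTransGen_swap.2 hb) ha' hb'

theorem not_transGen_self_of_initial (hr : Relator.LeftUnique r) {a b : α}
    (hab : Relation.ReflTransGen r a b) (ha : ∀ x, ¬ r x a) : ¬ Relation.TransGen r b b := by
  induction hab with
  | refl => exact fun h => let ⟨x, _, hx⟩ := Relation.TransGen.tail'_iff.1 h; ha x hx
  | @tail b c _ hbc ih =>
    intro h
    obtain ⟨x, hcx, hxc⟩ := Relation.TransGen.tail'_iff.1 h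
    obtain rfl := hr hbc hxc
    exact ih (Relation.TransGen.head' hbc hcx)

end Relations

/-! ### Formulas and blame -/

namespace Formula

theorem posOcc_dual (A : Formula) (m : List Dir) : A.dual.PosOcc m ↔ A.NegOcc m := by
  induction A generalizing m <;> rcases m with _ | ⟨_ | _, m⟩ <;> simp_all [dual, PosOcc, NegOcc]

theorem negOcc_dual (A : Formula) (m : List Dir) : A.dual.NegOcc m ↔ A.PosOcc m := by
  rw [← posOcc_dual, dual_dual]

theorem PosOcc.not_negOcc {A : Formula} {m : List Dir} (h : A.PosOcc m) : ¬ A.NegOcc m := by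
  induction A generalizing m <;> rcases m with _ | ⟨_ | _, m⟩ <;> simp_all [PosOcc, NegOcc]

theorem IsPositive.not_negOcc {A : Formula} (h : A.IsPositive) (m : List Dir) : ¬ A.NegOcc m := by
  induction A generalizing m <;> rcases m with _ | ⟨_ | _, m⟩ <;>
    simp_all [IsPositive, NegOcc]

theorem IsNegative.not_posOcc {A : Formula} (h : A.IsNegative) (m : List Dir) : ¬ A.PosOcc m := by
  induction A generalizing m <;> rcases m with _ | ⟨_ | _, m⟩ <;>
    simp_all [IsNegative, PosOcc]

theorem occ_one {m : List Dir} : one.Occ m ↔ m = [] := by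
  cases m <;> simp [Occ, PosOcc, NegOcc]

theorem occ_bot {m : List Dir} : bot.Occ m ↔ m = [] := by
  cases m <;> simp [Occ, PosOcc, NegOcc]

theorem occ_var {n : ℕ} {m : List Dir} : (var n).Occ m ↔ m = [] := by
  cases m <;> simp [Occ, PosOcc, NegOcc]

theorem occ_covar {n : ℕ} {m : List Dir} : (covar n).Occ m ↔ m = [] := by
  cases m <;> simp [Occ, PosOcc, NegOcc]

theorem occ_tensor {A B : Formula} {m : List Dir} : (tensor A B).Occ m ↔
    (∃ m', A.Occ m' ∧ Dir.left :: m' = m) ∨ ∃ m', B.Occ m' ∧ Dir.right :: m' = m := by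
  rcases m with _ | ⟨_ | _, m⟩ <;> simp [Occ, PosOcc, NegOcc]

theorem occ_par {A B : Formula} {m : List Dir} : (par A B).Occ m ↔
    (∃ m', A.Occ m' ∧ Dir.left :: m' = m) ∨ ∃ m', B.Occ m' ∧ Dir.right :: m' = m := by
  rcases m with _ | ⟨_ | _, m⟩ <;> simp [Occ, PosOcc, NegOcc]

theorem exists_occ (A : Formula) : ∃ m, A.Occ m := by
  induction A with
  | tensor A B hA _ => exact hA.imp' (Dir.left :: ·) fun _ h => h
  | par A B hA _ => exact hA.imp' (Dir.left :: ·) fun _ h => h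
  | one | var => exact ⟨[], Or.inl trivial⟩
  | bot | covar => exact ⟨[], Or.inr trivial⟩

theorem finite_occ (A : Formula) : {m | A.Occ m}.Finite := by
  induction A with
  | tensor A B hA hB =>
    exact ((hA.image (Dir.left :: ·)).union (hB.image (Dir.right :: ·))).subset
      fun _ => occ_tensor.1
  | par A B hA hB =>
    exact ((hA.image (Dir.left :: ·)).union (hB.image (Dir.right :: ·))).subset
      fun _ => occ_par.1
  | _ => simp only [occ_one, occ_bot, occ_var, occ_covar, Set.ofPred_eq_eq_singleton,
      Set.finite_singleton]

end Formula

/-- The link at which the tokens missing on an edge got stuck: the source or the target of the edge;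
`nobody` if none is missing. -/
inductive Blame : Type
  | nobody : Blame
  | source : Blame
  | target : Blame

namespace Blame

/-- Exchange of source and target, for the dual of a formula. -/
def flip : Blame → Blame
  | nobody => nobody
  | source => target
  | target => source

/-- The blame on an edge of type `A ⊗ B` in terms of the blames on `A` and on `B`: it goes to the
source as soon as one of them does. -/
def tensor : Blame → Blame → Blame
  | source, _ => source
  | _, source => source
  | target, _ => target
  | _, target => target
  | nobody, nobody => nobody

/-- The blame on an edge of type `A ⅋ B`: the De Morgan dual of `Blame.tensor`. -/
def par (x y : Blame) : Blame :=
  (x.flip.tensor y.flip).flip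

theorem flip_tensor (x y : Blame) : (x.tensor y).flip = x.flip.par y.flip := by
  cases x <;> cases y <;> rfl

theorem flip_par (x y : Blame) : (x.par y).flip = x.flip.tensor y.flip := by
  cases x <;> cases y <;> rfl

theorem tensor_eq_nobody {x y : Blame} : x.tensor y = nobody ↔ x = nobody ∧ y = nobody := by
  cases x <;> cases y <;> simp [tensor]

theorem par_eq_nobody {x y : Blame} : x.par y = nobody ↔ x = nobody ∧ y = nobody := by
  cases x <;> cases y <;> simp [par, tensor, flip]

theorem par_eq_target {x y : Blame} : x.par y = target ↔ x = target ∨ y = target := by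
  cases x <;> cases y <;> simp [par, tensor, flip]

theorem eq_target_of_tensor_eq_target {x y : Blame} (h : x.tensor y = target) :
    x = target ∨ y = target := by
  revert h
  cases x <;> cases y <;> simp [tensor]

theorem eq_source_of_par_eq_source {x y : Blame} (h : x.par y = source) :
    x = source ∨ y = source := by
  revert h
  cases x <;> cases y <;> simp [par, tensor, flip]

end Blame

namespace Formula

open Classical in
/-- The blame on an edge of type `A` when `v` is the set of the addresses at which the atoms of `A`
have been visited. A positive atom is reached from the source of the edge, a negative one from its
target. -/
noncomputable def blame : Formula → (List Dir → Prop) → Blame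
  | one, v | var _, v => if v [] then Blame.nobody else Blame.source
  | bot, v | covar _, v => if v [] then Blame.nobody else Blame.target
  | tensor A B, v =>
    (A.blame fun m => v (Dir.left :: m)).tensor (B.blame fun m => v (Dir.right :: m))
  | par A B, v => (A.blame fun m => v (Dir.left :: m)).par (B.blame fun m => v (Dir.right :: m))

theorem blame_dual (A : Formula) (v : List Dir → Prop) : A.dual.blame v = (A.blame v).flip := by
  induction A generalizing v with
  | tensor A B hA hB => simp only [dual, blame, hA, hB, Blame.flip_tensor]
  | par A B hA hB => simp only [dual, blame, hA, hB, Blame.flip_par]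
  | _ => by_cases h : v [] <;> simp [dual, blame, Blame.flip, h]

theorem blame_eq_nobody_iff {A : Formula} {v : List Dir → Prop} :
    A.blame v = Blame.nobody ↔ ∀ m, A.Occ m → v m := by
  induction A generalizing v with
  | tensor A B hA hB => simp [blame, Blame.tensor_eq_nobody, hA, hB, occ_tensor, or_imp, forall_and]
  | par A B hA hB => simp [blame, Blame.par_eq_nobody, hA, hB, occ_par, or_imp, forall_and]
  | _ => simp [blame, occ_one, occ_bot, occ_var, occ_covar]

theorem blame_congr {A : Formula} {v w : List Dir → Prop} (h : ∀ m, A.Occ m → (v m ↔ w m)) :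
    A.blame v = A.blame w := by
  induction A generalizing v w with
  | tensor A B hA hB =>
    exact congrArg₂ Blame.tensor (hA fun m => h (Dir.left :: m)) (hB fun m => h (Dir.right :: m))
  | par A B hA hB =>
    exact congrArg₂ Blame.par (hA fun m => h (Dir.left :: m)) (hB fun m => h (Dir.right :: m))
  | one | var => rw [blame, blame, propext (h [] (Or.inl trivial))]
  | bot | covar => rw [blame, blame, propext (h [] (Or.inr trivial))]

theorem blame_ne_target {A : Formula} {v : List Dir → Prop} (h : ∀ m, A.NegOcc m → v m) :
    A.blame v ≠ Blame.target := by
  induction A generalizing v with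
  | tensor A B hA hB =>
    intro ht
    exact (Blame.eq_target_of_tensor_eq_target ht).elim (hA fun m => h (Dir.left :: m))
      (hB fun m => h (Dir.right :: m))
  | par A B hA hB =>
    intro ht
    exact (Blame.par_eq_target.1 ht).elim (hA fun m => h (Dir.left :: m))
      (hB fun m => h (Dir.right :: m))
  | one | var => by_cases hv : v [] <;> simp [blame, hv]
  | bot | covar => simp [blame, h [] trivial]

theorem blame_ne_source {A : Formula} {v : List Dir → Prop} (h : ∀ m, A.PosOcc m → v m) :
    A.blame v ≠ Blame.source := by
  have hd : A.dual.blame v ≠ Blame.target := blame_ne_target fun m => by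
    rw [negOcc_dual]; exact h m
  intro hs
  rw [blame_dual, hs] at hd
  exact hd rfl

end Formula

/-! ### The paths of tokens -/

/-- The sides of the links, at the level of single occurrences of atoms: `premiss e m` is the
address `m` of an edge `e` that enters a link, `conclusion e m` of one that leaves it. The
conclusions of the content of a box count as edges that enter the box. -/
inductive Port (E : Type) : Type
  | premiss (e : E) (m : List Dir) : Port E
  | conclusion (e : E) (m : List Dir) : Port E

namespace Port

variable {E : Type}

/-- The position of the machine to which the port belongs. -/
def pos : Port E → Pos E
  | premiss e m => Pos.atom e m
  | conclusion e m => Pos.atom e m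

/-- A token on the port is about to cross the link. -/
def Incoming (ty : E → Formula) : Port E → Prop
  | premiss e m => (ty e).PosOcc m
  | conclusion e m => (ty e).NegOcc m

/-- A token on the port has left the link. -/
def Outgoing (ty : E → Formula) : Port E → Prop
  | premiss e m => (ty e).NegOcc m
  | conclusion e m => (ty e).PosOcc m

/-- The port is one of the ports of the link `k`. -/
def IsAt (k : Link E) : Port E → Prop
  | premiss e _ => e ∈ k.premisses ∨ e ∈ k.inner
  | conclusion e _ => e ∈ k.conclusions

variable {ty : E → Formula} {π ρ : Port E}

theorem Incoming.eq_of_pos_eq (hπ : π.Incoming ty) (hρ : ρ.Incoming ty) (h : π.pos = ρ.pos) :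
    π = ρ := by
  cases π <;> cases ρ <;> cases h <;> first | rfl | skip
  · exact absurd hρ (Formula.PosOcc.not_negOcc hπ)
  · exact absurd hπ (Formula.PosOcc.not_negOcc hρ)

theorem Outgoing.eq_of_pos_eq (hπ : π.Outgoing ty) (hρ : ρ.Outgoing ty) (h : π.pos = ρ.pos) :
    π = ρ := by
  cases π <;> cases ρ <;> cases h <;> first | rfl | skip
  · exact absurd hπ (Formula.PosOcc.not_negOcc hρ)
  · exact absurd hρ (Formula.PosOcc.not_negOcc hπ)

end Port

namespace Link

open Port

variable {E : Type} {ty : E → Formula} {k : Link E} {π ρ σ : Port E}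

/-- The pairs of ports between which tokens cross a link, in one of the two directions. -/
inductive Wire : Link E → Port E → Port E → Prop
  | ax (e f : E) (m : List Dir) : Wire (Link.ax e f) (conclusion e m) (conclusion f m)
  | cut (e f : E) (m : List Dir) : Wire (Link.cut e f) (premiss e m) (premiss f m)
  | tensor_left (a b c : E) (m : List Dir) :
      Wire (Link.tensor a b c) (premiss a m) (conclusion c (Dir.left :: m))
  | tensor_right (a b c : E) (m : List Dir) :
      Wire (Link.tensor a b c) (premiss b m) (conclusion c (Dir.right :: m))
  | par_left (a b c : E) (m : List Dir) :
      Wire (Link.par a b c) (premiss a m) (conclusion c (Dir.left :: m))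
  | par_right (a b c : E) (m : List Dir) :
      Wire (Link.par a b c) (premiss b m) (conclusion c (Dir.right :: m))
  | sync (ps : List (E × E)) (a c : E) (m : List Dir) : (a, c) ∈ ps →
      Wire (Link.sync ps) (premiss a m) (conclusion c m)
  | door (e : E) (ds : List (E × E)) (d c : E) (m : List Dir) : (d, c) ∈ ds →
      Wire (Link.box e ds) (premiss d m) (conclusion c m)

theorem Wire.right_unique (hp : k.premisses.Nodup) (hi : k.inner.Nodup) :
    Relator.RightUnique k.Wire := by
  rintro _ _ _ h h'
  cases h with
  | sync ps a c m hac =>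
    cases h' with
    | sync _ _ _ _ hac' => cases List.inj_on_of_nodup_map hp hac hac' rfl; rfl
  | door e ds d c m hdc =>
    cases h' with
    | door _ _ _ _ _ hdc' => cases List.inj_on_of_nodup_map hi hdc hdc' rfl; rfl
  | _ => cases h' <;> first | rfl | simp [premisses] at hp

theorem Wire.left_unique (hc : k.conclusions.Nodup) : Relator.LeftUnique k.Wire := by
  rintro _ _ _ h h'
  cases h with
  | sync ps a c m hac =>
    cases h' with
    | sync _ _ _ _ hac' => cases List.inj_on_of_nodup_map hc hac hac' rfl; rfl
  | door e ds d c m hdc =>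
    cases h' with
    | door _ _ _ _ _ hdc' =>
      cases List.inj_on_of_nodup_map (List.nodup_cons.1 hc).2 hdc hdc' rfl; rfl
  | _ => cases h'; rfl

theorem Wire.not_wire (hp : k.premisses.Nodup) (hc : k.conclusions.Nodup) (h : k.Wire π ρ) :
    ¬ k.Wire ρ σ := by
  intro h'
  cases h <;> cases h' <;> simp_all [premisses, conclusions]

/-- The symmetric closure of `Link.Wire`. -/
def Joined (k : Link E) : Port E → Port E → Prop :=
  Relation.SymmGen k.Wire

theorem Joined.symm (h : k.Joined π ρ) : k.Joined ρ π :=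
  Or.symm h

theorem Joined.right_unique (hp : k.premisses.Nodup) (hc : k.conclusions.Nodup)
    (hi : k.inner.Nodup) : Relator.RightUnique k.Joined := by
  rintro π ρ σ (h | h) (h' | h')
  · exact Wire.right_unique hp hi h h'
  · exact absurd h (Wire.not_wire hp hc h')
  · exact absurd h' (Wire.not_wire hp hc h)
  · exact Wire.left_unique hc h h'

theorem Wire.isAt (h : k.Wire π ρ) : π.IsAt k ∧ ρ.IsAt k := by
  cases h <;> simp only [IsAt, premisses, conclusions, inner] <;> grind

theorem Joined.isAt (h : k.Joined π ρ) : π.IsAt k :=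
  h.elim (fun h => h.isAt.1) fun h => h.isAt.2

theorem Wire.incoming_iff (hk : k.WellTyped ty) (h : k.Wire π ρ) :
    (π.Incoming ty ↔ ρ.Outgoing ty) ∧ (π.Outgoing ty ↔ ρ.Incoming ty) := by
  cases h with
  | ax | cut =>
    simp only [WellTyped] at hk
    simp only [Incoming, Outgoing, hk, Formula.posOcc_dual, Formula.negOcc_dual, and_self]
  | sync ps a c m h => simp [Incoming, Outgoing, (hk.2 _ h).1]
  | door e ds d c m h => simp [Incoming, Outgoing, hk.2 _ h]
  | _ =>
    simp only [WellTyped] at hk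
    simp only [Incoming, Outgoing, hk, Formula.PosOcc, Formula.NegOcc, and_self]

theorem Joined.incoming_iff (hk : k.WellTyped ty) (h : k.Joined π ρ) :
    π.Incoming ty ↔ ρ.Outgoing ty :=
  h.elim (fun h => (h.incoming_iff hk).1) fun h => (h.incoming_iff hk).2.symm

theorem exists_joined_premiss {e : E} {m : List Dir} (h : (premiss e m).IsAt k) :
    ∃ ρ, k.Joined (premiss e m) ρ := by
  cases k with
  | cut a b =>
    obtain rfl | rfl : e = a ∨ e = b := by simpa [IsAt, premisses, inner] using h
    exacts [⟨_, Or.inl (.cut _ _ _)⟩, ⟨_, Or.inr (.cut _ _ _)⟩]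
  | tensor a b c =>
    obtain rfl | rfl : e = a ∨ e = b := by simpa [IsAt, premisses, inner] using h
    exacts [⟨_, Or.inl (.tensor_left _ _ _ _)⟩, ⟨_, Or.inl (.tensor_right _ _ _ _)⟩]
  | par a b c =>
    obtain rfl | rfl : e = a ∨ e = b := by simpa [IsAt, premisses, inner] using h
    exacts [⟨_, Or.inl (.par_left _ _ _ _)⟩, ⟨_, Or.inl (.par_right _ _ _ _)⟩]
  | sync ps =>
    obtain ⟨c, hc⟩ : ∃ c, (e, c) ∈ ps := by simpa [IsAt, premisses, inner] using h
    exact ⟨_, Or.inl (.sync _ _ _ _ hc)⟩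
  | box a ds =>
    obtain ⟨c, hc⟩ : ∃ c, (e, c) ∈ ds := by simpa [IsAt, premisses, inner] using h
    exact ⟨_, Or.inl (.door _ _ _ _ _ hc)⟩
  | _ => simp [IsAt, premisses, inner] at h

theorem exists_joined_conclusion {e : E} {m : List Dir} (hk : k.WellTyped ty)
    (he : e ∈ k.conclusions) (hm : (ty e).NegOcc m) :
    (∃ ρ, k.Joined (conclusion e m) ρ) ∨ ∃ ds, k = box e ds ∧ m = [] := by
  cases k with
  | ax a b =>
    obtain rfl | rfl : e = a ∨ e = b := by simpa [conclusions] using he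
    exacts [Or.inl ⟨_, Or.inl (.ax _ _ _)⟩, Or.inl ⟨_, Or.inr (.ax _ _ _)⟩]
  | cut => simp [conclusions] at he
  | tensor a b c =>
    obtain rfl := List.mem_singleton.1 he
    rw [hk] at hm
    rcases m with _ | ⟨_ | _, m⟩
    exacts [hm.elim, Or.inl ⟨_, Or.inr (.tensor_left _ _ _ _)⟩,
      Or.inl ⟨_, Or.inr (.tensor_right _ _ _ _)⟩]
  | par a b c =>
    obtain rfl := List.mem_singleton.1 he
    rw [hk] at hm
    rcases m with _ | ⟨_ | _, m⟩
    exacts [hm.elim, Or.inl ⟨_, Or.inr (.par_left _ _ _ _)⟩,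
      Or.inl ⟨_, Or.inr (.par_right _ _ _ _)⟩]
  | one a =>
    obtain rfl := List.mem_singleton.1 he
    rw [hk] at hm
    cases m <;> exact hm.elim
  | sync ps =>
    obtain ⟨a, ha⟩ : ∃ a, (a, e) ∈ ps := by simpa [conclusions] using he
    exact Or.inl ⟨_, Or.inr (.sync _ _ _ _ ha)⟩
  | box a ds =>
    rcases List.mem_cons.1 he with rfl | he
    · rw [hk.1] at hm
      exact Or.inr ⟨ds, rfl, Formula.occ_bot.1 (Or.inr hm)⟩
    · obtain ⟨d, hd⟩ : ∃ d, (d, e) ∈ ds := by simpa using he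
      exact Or.inl ⟨_, Or.inr (.door _ _ _ _ _ hd)⟩

theorem not_joined_one (e : E) : ¬ (one e).Joined π ρ := by
  rintro (h | h) <;> cases h

theorem not_joined_lock {e : E} {ds : List (E × E)} {m : List Dir}
    (hc : (box e ds).conclusions.Nodup) : ¬ (box e ds).Joined (conclusion e m) ρ := by
  rintro (h | h)
  · cases h
  · cases h with
    | door _ _ d _ _ hd => exact (List.nodup_cons.1 hc).1 (List.mem_map_of_mem hd)

end Link

namespace Structure

open Port

variable {L E : Type} {R : Structure L E} {l l' : L} {p p' q q' : Pos E} {π ρ : Port E}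

/-- The positions at which tokens enter the machine. -/
def origins (R : Structure L E) : Set (Pos E) :=
  R.INIT ∪ R.ONES

theorem source_unique {e : E} (h : e ∈ (R.link l).conclusions) (h' : e ∈ (R.link l').conclusions) :
    l = l' :=
  (R.source e).unique h h'

theorem isAt_unique (h : π.IsAt (R.link l)) (h' : π.IsAt (R.link l')) : l = l' := by
  cases π with
  | conclusion e m => exact source_unique h h'
  | premiss e m =>
    rcases h with h | h <;> rcases h' with h' | h'
    · exact R.target e l l' h h'
    · exact absurd h (((R.inner_iff l' e).1 h').2 l)
    · exact absurd h' (((R.inner_iff l e).1 h).2 l')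
    · obtain ⟨k, hk, hek⟩ := ((R.inner_iff l e).1 h).1
      obtain ⟨k', hk', hek'⟩ := ((R.inner_iff l' e).1 h').1
      obtain rfl := source_unique hek hek'
      exact Option.some_injective _ (hk.symm.trans hk')

theorem joined_right_unique (R : Structure L E) (l : L) :
    Relator.RightUnique (R.link l).Joined :=
  Link.Joined.right_unique (R.premisses_nodup l) (R.conclusions_nodup l) (R.inner_nodup l)

/-- A token on the position `p` next crosses the link `l`, to the position `q`; a token that opens
the lock of a box ends up on the position `(e, 0)` of the lock `e`. -/
inductive Via (R : Structure L E) (l : L) (p q : Pos E) : Prop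
  | wire (π ρ : Port E) : (R.link l).Joined π ρ → π.Incoming R.ty → p = π.pos → q = ρ.pos →
      Via R l p q
  | unlock (e : E) (ds : List (E × E)) : R.link l = Link.box e ds → p = Pos.atom e [] →
      q = Pos.lock e 0 → Via R l p q

/-- The path of a token does not depend on the other tokens: its next position is determined, only
the time at which it moves there is not. -/
def Next (R : Structure L E) (p q : Pos E) : Prop :=
  ∃ l, R.Via l p q

theorem ty_one {e : E} (h : R.link l = Link.one e) : R.ty e = Formula.one := by
  have hty := R.wellTyped l
  rwa [h] at hty

theorem ty_lock {e : E} {ds : List (E × E)} (h : R.link l = Link.box e ds) :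
    R.ty e = Formula.bot := by
  have hty := R.wellTyped l
  rw [h] at hty
  exact hty.1

theorem incoming_lock {e : E} {ds : List (E × E)} (h : R.link l = Link.box e ds) :
    (conclusion e []).Incoming R.ty := by
  simp [Incoming, ty_lock h, Formula.NegOcc]

theorem mem_conclusions_lock {e : E} {ds : List (E × E)} (h : R.link l = Link.box e ds) :
    e ∈ (R.link l).conclusions := by
  simp [h, Link.conclusions]

theorem Via.exists_incoming (h : R.Via l p q) :
    ∃ π : Port E, π.IsAt (R.link l) ∧ π.Incoming R.ty ∧ p = π.pos := by
  rcases h with ⟨π, ρ, hj, hπ, rfl, -⟩ | ⟨e, ds, hl, rfl, -⟩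
  · exact ⟨π, hj.isAt, hπ, rfl⟩
  · exact ⟨conclusion e [], mem_conclusions_lock hl, incoming_lock hl, rfl⟩

theorem Via.link_unique (h : R.Via l p q) (h' : R.Via l' p q') : l = l' := by
  obtain ⟨π, hl, hπ, rfl⟩ := h.exists_incoming
  obtain ⟨π', hl', hπ', hpos⟩ := h'.exists_incoming
  obtain rfl := hπ.eq_of_pos_eq hπ' hpos
  exact isAt_unique hl hl'

theorem joined_outgoing (h : (R.link l).Joined π ρ) (hπ : π.Incoming R.ty) : ρ.Outgoing R.ty :=
  (h.incoming_iff (R.wellTyped l)).1 hπ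

theorem pos_ne_lock_of_joined {e : E} {ds : List (E × E)} (hl : R.link l = Link.box e ds)
    (hj : (R.link l).Joined π ρ) (hπ : π.Incoming R.ty) : π.pos ≠ Pos.atom e [] := by
  intro h
  obtain rfl := hπ.eq_of_pos_eq (incoming_lock hl) h
  rw [hl] at hj
  exact Link.not_joined_lock (hl ▸ R.conclusions_nodup l) hj

theorem next_right_unique (R : Structure L E) : Relator.RightUnique R.Next := by
  rintro p q q' ⟨l, h⟩ ⟨l', h'⟩
  obtain rfl := h.link_unique h'
  rcases h with ⟨π, ρ, hj, hπ, rfl, rfl⟩ | ⟨e, ds, hl, rfl, rfl⟩ <;>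
    rcases h' with ⟨π', ρ', hj', hπ', hp, rfl⟩ | ⟨e', ds', hl', hp, rfl⟩
  · obtain rfl := hπ.eq_of_pos_eq hπ' hp
    rw [R.joined_right_unique l hj hj']
  · exact absurd hp (pos_ne_lock_of_joined hl' hj hπ)
  · exact absurd hp.symm (pos_ne_lock_of_joined hl hj' hπ')
  · cases hp; rfl

theorem next_left_unique (R : Structure L E) : Relator.LeftUnique R.Next := by
  rintro p p' q ⟨l, h⟩ ⟨l', h'⟩
  rcases h with ⟨π, ρ, hj, hπ, rfl, rfl⟩ | ⟨e, _, -, rfl, rfl⟩ <;>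
    rcases h' with ⟨π', ρ', hj', hπ', rfl, hq⟩ | ⟨_, _, -, rfl, hq⟩
  · obtain rfl := (joined_outgoing hj hπ).eq_of_pos_eq (joined_outgoing hj' hπ') hq
    obtain rfl := isAt_unique hj.symm.isAt hj'.symm.isAt
    rw [R.joined_right_unique l hj.symm hj'.symm]
  · cases ρ <;> cases hq
  · cases ρ' <;> cases hq
  · cases hq; rfl

theorem not_isAt_of_isConclusion {e : E} {m : List Dir} (he : R.IsConclusion e) :
    ¬ (premiss e m).IsAt (R.link l) := by
  rintro (h | h)
  · exact he.2 l h
  · obtain ⟨⟨k, hk, hek⟩, -⟩ := (R.inner_iff l e).1 h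
    obtain ⟨⟨k', hk', hek'⟩, -⟩ := he
    obtain rfl := source_unique hek hek'
    simp [hk'] at hk

theorem not_next_of_mem_origins (hq : q ∈ R.origins) : ¬ R.Next p q := by
  rintro ⟨l, ⟨π, ρ, hj, hπ, rfl, rfl⟩ | ⟨_, _, -, rfl, rfl⟩⟩
  · have hρ := joined_outgoing hj hπ
    rcases hq with ⟨e, m, he, hm, hpos⟩ | ⟨k, e, hk, hpos⟩
    · obtain rfl := hρ.eq_of_pos_eq (ρ := premiss e m) hm hpos
      exact not_isAt_of_isConclusion he hj.symm.isAt
    · obtain rfl := hρ.eq_of_pos_eq (ρ := conclusion e [])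
        (by simp [Outgoing, ty_one hk, Formula.PosOcc]) hpos
      obtain rfl : k = l := source_unique (by simp [hk, Link.conclusions]) hj.symm.isAt
      rw [hk] at hj
      exact Link.not_joined_one e hj
  · rcases hq with ⟨e, m, -, -, hpos⟩ | ⟨k, e, -, hpos⟩ <;> cases hpos

theorem exists_via_of_incoming (hπ : π.Incoming R.ty) (h : π.IsAt (R.link l)) :
    ∃ q, R.Via l π.pos q := by
  cases π with
  | premiss e m =>
    obtain ⟨ρ, hj⟩ := Link.exists_joined_premiss h
    exact ⟨ρ.pos, .wire _ ρ hj hπ rfl rfl⟩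
  | conclusion e m =>
    rcases Link.exists_joined_conclusion (R.wellTyped l) h hπ with ⟨ρ, hj⟩ | ⟨ds, hl, rfl⟩
    · exact ⟨ρ.pos, .wire _ ρ hj hπ rfl rfl⟩
    · exact ⟨Pos.lock e 0, .unlock e ds hl rfl rfl⟩

theorem isConclusion_or_exists_isAt (R : Structure L E) (e : E) :
    R.IsConclusion e ∨ ∃ l, ∀ m, (premiss e m).IsAt (R.link l) := by
  by_cases h : ∃ l, e ∈ (R.link l).premisses
  · exact Or.inr (h.imp fun l hl _ => Or.inl hl)
  · push Not at h
    obtain ⟨k, hk, -⟩ := R.source e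
    cases hb : R.boxOf k with
    | none => exact Or.inl ⟨⟨k, hb, hk⟩, h⟩
    | some b => exact Or.inr ⟨b, fun _ => Or.inr ((R.inner_iff b e).2 ⟨⟨k, hb, hk⟩, h⟩)⟩

theorem mem_FIN_or_exists_next {e : E} {m : List Dir} (h : (R.ty e).Occ m) :
    Pos.atom e m ∈ R.FIN ∨ ∃ q, R.Next (Pos.atom e m) q := by
  rcases h with h | h
  · rcases R.isConclusion_or_exists_isAt e with he | ⟨l, hl⟩
    · exact Or.inl ⟨e, m, he, h, rfl⟩
    · exact Or.inr ((exists_via_of_incoming (π := premiss e m) h (hl m)).imp fun _ h => ⟨l, h⟩)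
  · obtain ⟨l, hl, -⟩ := R.source e
    exact Or.inr ((exists_via_of_incoming (π := conclusion e m) h hl).imp fun _ h => ⟨l, h⟩)

theorem not_next_of_mem_FIN (hp : p ∈ R.FIN) : ¬ R.Next p q := by
  rintro ⟨l, h⟩
  obtain ⟨π, hl, hπ, rfl⟩ := h.exists_incoming
  obtain ⟨e, m, he, hm, hpos⟩ := hp
  obtain rfl := hπ.eq_of_pos_eq (ρ := premiss e m) hm hpos
  exact not_isAt_of_isConclusion he hl

theorem not_next_lock {e : E} {i : ℕ} : ¬ R.Next (Pos.lock e i) q := by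
  rintro ⟨l, h⟩
  obtain ⟨π, -, -, hpos⟩ := h.exists_incoming
  cases π <;> cases hpos

/-- The positions that tokens can reach: those on the atoms of the edges, and `(e, 0)` for the
locks `e`. -/
def stations (R : Structure L E) : Set (Pos E) :=
  {p | (∃ e m, (R.ty e).Occ m ∧ p = Pos.atom e m) ∨ ∃ e, R.IsLock e ∧ p = Pos.lock e 0}

theorem finite_stations [Finite E] (R : Structure L E) : R.stations.Finite := by
  refine ((Set.finite_iUnion fun e => (R.ty e).finite_occ.image (Pos.atom e)).union
    (Set.finite_range fun e : E => Pos.lock e 0)).subset ?_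
  rintro _ (⟨e, m, hm, rfl⟩ | ⟨e, -, rfl⟩)
  · exact Or.inl (Set.mem_iUnion.2 ⟨e, m, hm, rfl⟩)
  · exact Or.inr ⟨e, rfl⟩

theorem stations_subset_POS : R.stations ⊆ R.POS := by
  rintro _ (h | ⟨e, he, rfl⟩)
  · exact Or.inl h
  · exact Or.inr ⟨e, 0, he, rfl⟩

theorem pos_mem_stations_of_outgoing (h : π.Outgoing R.ty) : π.pos ∈ R.stations := by
  cases π with
  | premiss e m => exact Or.inl ⟨e, m, Or.inr h, rfl⟩
  | conclusion e m => exact Or.inl ⟨e, m, Or.inl h, rfl⟩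

theorem exists_atom_of_mem_origins (h : p ∈ R.origins) :
    ∃ e m, (R.ty e).Occ m ∧ p = Pos.atom e m := by
  rcases h with ⟨e, m, -, hm, rfl⟩ | ⟨l, e, hl, rfl⟩
  · exact ⟨e, m, Or.inr hm, rfl⟩
  · exact ⟨e, [], by rw [ty_one hl, Formula.occ_one], rfl⟩

theorem origins_subset_stations : R.origins ⊆ R.stations :=
  fun _ h => Or.inl (exists_atom_of_mem_origins h)

theorem Next.mem_stations (h : R.Next p q) : q ∈ R.stations := by
  obtain ⟨l, ⟨π, ρ, hj, hπ, -, rfl⟩ | ⟨e, ds, hl, -, rfl⟩⟩ := h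
  · exact pos_mem_stations_of_outgoing (joined_outgoing hj hπ)
  · exact Or.inr ⟨e, ⟨l, ds, hl⟩, rfl⟩

end Structure

/-! ### Coherent states -/

namespace Structure

namespace State

open Port

variable {L E : Type} {R : Structure L E} {T U : R.State} {l : L} {p q s t x : Pos E}

theorem ext (h : T.tok = U.tok) : T = U := by
  cases T; cases U; cases h; rfl

theorem mem_origins_of_tok (h : T.tok s = some p) : s ∈ R.origins := by
  obtain ⟨S, hS, hdom⟩ := T.dom
  exact ((hdom s).1 ⟨p, h⟩).imp_right (@hS s)

theorem exists_tok_of_mem_INIT (T : R.State) (h : s ∈ R.INIT) : ∃ p, T.tok s = some p := by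
  obtain ⟨S, -, hdom⟩ := T.dom
  exact (hdom s).2 (Or.inl h)

theorem exists_tok_eq {f : Pos E → Option (Pos E)} (hINIT : ∀ s ∈ R.INIT, ∃ p, f s = some p)
    (horigins : ∀ s p, f s = some p → s ∈ R.origins) (hPOS : ∀ s p, f s = some p → p ∈ R.POS) :
    ∃ U : R.State, U.tok = f := by
  refine ⟨⟨f, ⟨{s | s ∈ R.ONES ∧ ∃ p, f s = some p}, fun s h => h.1, fun s => ⟨?_, ?_⟩⟩, hPOS⟩, rfl⟩
  · rintro ⟨p, hp⟩
    exact (horigins s p hp).imp_right fun h => ⟨h, p, hp⟩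
  · rintro (h | h)
    exacts [hINIT s h, h.2]

theorem exists_tok_update (T : R.State) (hs : s ∈ R.origins) (hq : q ∈ R.POS) :
    ∃ U : R.State, U.tok s = some q ∧ ∀ t, t ≠ s → U.tok t = T.tok t := by
  classical
  obtain ⟨U, hU⟩ := exists_tok_eq (f := Function.update T.tok s (some q))
    (fun t ht => (eq_or_ne t s).elim (fun h => ⟨q, by simp [h]⟩) fun h => by
      simpa [h] using T.exists_tok_of_mem_INIT ht)
    (fun t p ht => (eq_or_ne t s).elim (fun h => h ▸ hs) fun h => by
      rw [Function.update_of_ne h] at ht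
      exact mem_origins_of_tok ht)
    (fun t p ht => (eq_or_ne t s).elim (fun h => by simp_all) fun h => by
      rw [Function.update_of_ne h] at ht
      exact T.pos t p ht)
  exact ⟨U, by simp [hU], fun t ht => by simp [hU, ht]⟩

theorem exists_tok_map (T : R.State) {f : Pos E → Pos E} (hf : Set.MapsTo f R.POS R.POS) :
    ∃ U : R.State, ∀ t, U.tok t = (T.tok t).map f := by
  obtain ⟨U, hU⟩ := exists_tok_eq (R := R) (f := fun t => (T.tok t).map f)
    (fun t ht => (T.exists_tok_of_mem_INIT ht).imp' f fun p hp => by simp [hp])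
    (fun t _ ht => by
      obtain ⟨p, hp, -⟩ := Option.map_eq_some_iff.1 ht
      exact mem_origins_of_tok hp)
    (fun t _ ht => by
      obtain ⟨p, hp, rfl⟩ := Option.map_eq_some_iff.1 ht
      exact hf (T.pos t p hp))
  exact ⟨U, congrFun hU⟩

theorem initialState_tok : R.initialState.tok s = some p ↔ s ∈ R.INIT ∧ s = p := by
  by_cases h : s ∈ R.INIT <;> simp [initialState, h]

theorem Move.exists_via (h : T.Move p q) : ∃ l, R.Via l p q ∧ ∀ ps, R.link l ≠ Link.sync ps := by
  have wired {l : L} {k : Link E} {π ρ : Port E} (hk : R.link l = k) (hj : k.Joined π ρ)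
      (hπ : π.Incoming R.ty) (hs : ∀ ps, k ≠ Link.sync ps) :
      ∃ l, R.Via l π.pos ρ.pos ∧ ∀ ps, R.link l ≠ Link.sync ps :=
    ⟨l, .wire π ρ (hk ▸ hj) hπ rfl rfl, hk ▸ hs⟩
  cases h with
  | ax_left l e f m h hm => exact wired h (Or.inl (.ax e f m)) hm (by simp)
  | ax_right l e f m h hm => exact wired h (Or.inr (.ax e f m)) hm (by simp)
  | cut_left l e f m h hm => exact wired h (Or.inl (.cut e f m)) hm (by simp)
  | cut_right l e f m h hm => exact wired h (Or.inr (.cut e f m)) hm (by simp)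
  | down_left l a b c m h hm =>
    rcases h with h | h
    exacts [wired h (Or.inl (.tensor_left a b c m)) hm (by simp),
      wired h (Or.inl (.par_left a b c m)) hm (by simp)]
  | down_right l a b c m h hm =>
    rcases h with h | h
    exacts [wired h (Or.inl (.tensor_right a b c m)) hm (by simp),
      wired h (Or.inl (.par_right a b c m)) hm (by simp)]
  | up_left l a b c m h hm =>
    rcases h with h | h
    exacts [wired h (Or.inr (.tensor_left a b c m)) hm (by simp),
      wired h (Or.inr (.par_left a b c m)) hm (by simp)]
  | up_right l a b c m h hm =>
    rcases h with h | h
    exacts [wired h (Or.inr (.tensor_right a b c m)) hm (by simp),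
      wired h (Or.inr (.par_right a b c m)) hm (by simp)]
  | unlock b e ds h => exact ⟨b, .unlock e ds h rfl rfl, by simp [h]⟩
  | exit_box b e ds d c m h hdc _ hm =>
    exact wired h (Or.inl (.door e ds d c m hdc)) hm (by simp)
  | enter_box b e ds d c m h hdc _ hm =>
    exact wired h (Or.inr (.door e ds d c m hdc)) hm (by simp)

theorem move_of_joined {π ρ : Port E} (hj : (R.link l).Joined π ρ) (hπ : π.Incoming R.ty)
    (hsync : ∀ ps, R.link l ≠ Link.sync ps) (hbox : (R.link l).IsBox → T.Unlocked l) :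
    T.Move π.pos ρ.pos := by
  generalize hk : R.link l = k at hj hsync hbox
  rcases hj with h | h
  · cases h with
    | ax e f m => exact .ax_left l e f m hk hπ
    | cut e f m => exact .cut_left l e f m hk hπ
    | tensor_left a b c m => exact .down_left l a b c m (Or.inl hk) hπ
    | tensor_right a b c m => exact .down_right l a b c m (Or.inl hk) hπ
    | par_left a b c m => exact .down_left l a b c m (Or.inr hk) hπ
    | par_right a b c m => exact .down_right l a b c m (Or.inr hk) hπ
    | sync ps a c m _ => exact absurd rfl (hsync ps)
    | door e ds d c m hdc => exact .exit_box l e ds d c m hk hdc (hbox ⟨e, ds, rfl⟩) hπ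
  · cases h with
    | ax e f m => exact .ax_right l e f m hk hπ
    | cut e f m => exact .cut_right l e f m hk hπ
    | tensor_left a b c m => exact .up_left l a b c m (Or.inl hk) hπ
    | tensor_right a b c m => exact .up_right l a b c m (Or.inl hk) hπ
    | par_left a b c m => exact .up_left l a b c m (Or.inr hk) hπ
    | par_right a b c m => exact .up_right l a b c m (Or.inr hk) hπ
    | sync ps a c m _ => exact absurd rfl (hsync ps)
    | door e ds d c m hdc => exact .enter_box l e ds d c m hk hdc (hbox ⟨e, ds, rfl⟩) hπ

theorem cross_iff_via {ps : List (E × E)} (hl : R.link l = Link.sync ps) :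
    Cross R ps p q ↔ R.Via l p q := by
  constructor
  · rintro (⟨a, c, m, h, hm⟩ | ⟨a, c, m, h, hm⟩)
    · exact .wire (premiss a m) (conclusion c m) (hl ▸ Or.inl (.sync ps a c m h)) hm rfl rfl
    · exact .wire (conclusion c m) (premiss a m) (hl ▸ Or.inr (.sync ps a c m h)) hm rfl rfl
  · rintro (⟨π, ρ, hj, hπ, rfl, rfl⟩ | ⟨e, ds, hbox, -, -⟩)
    · rw [hl] at hj
      rcases hj with h | h <;> cases h with | sync _ a c m h => ?_
      exacts [.down a c m h hπ, .up a c m h hπ]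
    · simp [hl] at hbox

theorem inEdge_of_cross {ps : List (E × E)} (hl : R.link l = Link.sync ps) {e : E} {m : List Dir}
    (h : Cross R ps (Pos.atom e m) q) : Link.InEdge R.ty ps e ∧ (R.ty e).Occ m := by
  have hwt := R.wellTyped l
  rw [hl] at hwt
  rcases h with ⟨_, c, _, h, hm⟩ | ⟨a, _, _, h, hm⟩
  · have hpos := (hwt.2 _ h).2.resolve_right fun hn => hn.not_posOcc m hm
    exact ⟨⟨_, h, Or.inl ⟨hpos, rfl⟩⟩, Or.inl hm⟩
  · refine ⟨⟨_, h, Or.inr ⟨?_, rfl⟩⟩, Or.inr hm⟩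
    have hpn := (hwt.2 _ h).2
    rw [(hwt.2 _ h).1] at hpn
    exact hpn.resolve_left fun hp => hp.not_negOcc m hm

theorem mem_image_of_cross {ps : List (E × E)} (hl : R.link l = Link.sync ps)
    (hsat : ∀ e, Link.InEdge R.ty ps e → T.Saturated e) (h : Cross R ps p q) : p ∈ T.image := by
  obtain ⟨e, m, rfl⟩ : ∃ e m, p = Pos.atom e m := by cases h <;> exact ⟨_, _, rfl⟩
  obtain ⟨he, hm⟩ := inEdge_of_cross hl h
  exact hsat e he m hm

theorem Step.tok_of_some (h : Step T U) (ht : T.tok t = some p) :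
    U.tok t = some p ∨ ∃ l q, R.Via l p q ∧ U.tok t = some q ∧
      ∀ ps p' q', R.link l = Link.sync ps → R.Via l p' q' → q' ∈ U.image := by
  cases h with
  | move s p' q hs hmove hU hstay =>
    by_cases hts : t = s
    · subst hts
      cases hs.symm.trans ht
      obtain ⟨l, hvia, hl⟩ := hmove.exists_via
      exact Or.inr ⟨l, q, hvia, hU, fun ps _ _ hps => absurd hps (hl ps)⟩
    · exact Or.inl ((hstay t hts).trans ht)
  | sync l ps hl hsat hcross hstay =>
    by_cases hp : ∃ q, Cross R ps p q
    · obtain ⟨q, hq⟩ := hp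
      refine Or.inr ⟨l, q, (cross_iff_via hl).1 hq, hcross t p q ht hq, fun _ p' q' _ hvia => ?_⟩
      have hc := (cross_iff_via hl).2 hvia
      obtain ⟨t', ht'⟩ := mem_image_of_cross hl hsat hc
      exact ⟨t', hcross t' p' q' ht' hc⟩
    · refine Or.inl ((hstay t fun p' q hp' hq => hp ⟨q, ?_⟩).trans ht)
      cases ht.symm.trans hp'
      exact hq
  | one l e _ _ hnone _ hstay =>
    refine Or.inl ((hstay t ?_).trans ht)
    rintro rfl
    simp [hnone] at ht

theorem Step.tok_of_none (h : Step T U) (ht : T.tok t = none) :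
    U.tok t = none ∨ t ∈ R.ONES ∧ U.tok t = some t := by
  cases h with
  | move s p' q hs _ _ hstay =>
    refine Or.inl ((hstay t ?_).trans ht)
    rintro rfl
    simp [hs] at ht
  | sync l ps hl _ _ hstay =>
    exact Or.inl ((hstay t fun p q hp => by simp [ht] at hp).trans ht)
  | one l e hl _ _ hU hstay =>
    by_cases hts : t = Pos.atom e []
    · subst hts
      exact Or.inr ⟨⟨l, e, hl, rfl⟩, hU⟩
    · exact Or.inl ((hstay t hts).trans ht)

theorem Step.cases_tok (h : Step T U) (ht : U.tok t = some q) :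
    T.tok t = some q ∨ (T.tok t = none ∧ t ∈ R.ONES ∧ t = q) ∨
      ∃ l p, R.Via l p q ∧ T.tok t = some p ∧
        ∀ ps p' q', R.link l = Link.sync ps → R.Via l p' q' → q' ∈ U.image := by
  cases hT : T.tok t with
  | none =>
    rcases h.tok_of_none hT with hU | ⟨hones, hU⟩
    · simp [hU] at ht
    · exact Or.inr (Or.inl ⟨rfl, hones, Option.some.inj (hU.symm.trans ht)⟩)
  | some p =>
    rcases h.tok_of_some hT with hU | ⟨l, q', hvia, hU, hsync⟩
    · exact Or.inl (hU.symm.trans ht)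
    · cases hU.symm.trans ht
      exact Or.inr (Or.inr ⟨l, p, hvia, rfl, hsync⟩)

theorem exists_step_of_move (hs : T.tok s = some p) (h : T.Move p q) : ∃ U, Step T U := by
  obtain ⟨l, hvia, -⟩ := h.exists_via
  obtain ⟨U, hUs, hU⟩ := T.exists_tok_update (mem_origins_of_tok hs)
    (stations_subset_POS (Next.mem_stations ⟨l, hvia⟩))
  exact ⟨U, .move s p q hs h hUs hU⟩

theorem exists_step_of_one {e : E} (hl : R.link l = Link.one e) (ha : T.Active l)
    (hT : T.tok (Pos.atom e []) = none) : ∃ U, Step T U := by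
  have he : Pos.atom e [] ∈ R.origins := Or.inr ⟨l, e, hl, rfl⟩
  obtain ⟨U, hUe, hU⟩ :=
    T.exists_tok_update he (stations_subset_POS (origins_subset_stations he))
  exact ⟨U, .one l e hl ha hT hUe hU⟩

theorem exists_step_of_sync {ps : List (E × E)} (hl : R.link l = Link.sync ps)
    (h : ∀ e, Link.InEdge R.ty ps e → T.Saturated e) : ∃ U, Step T U := by
  classical
  let f (p : Pos E) : Pos E := if h : ∃ q, Cross R ps p q then h.choose else p
  have next_of_cross {p q : Pos E} (hpq : Cross R ps p q) : R.Next p q :=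
    ⟨l, (cross_iff_via hl).1 hpq⟩
  have f_of_cross {p q : Pos E} (hpq : Cross R ps p q) : f p = q := by
    have hex : ∃ q, Cross R ps p q := ⟨q, hpq⟩
    simp only [f, dif_pos hex]
    exact R.next_right_unique (next_of_cross hex.choose_spec) (next_of_cross hpq)
  have f_of_not {p : Pos E} (hp : ∀ q, ¬ Cross R ps p q) : f p = p :=
    dif_neg (not_exists.2 hp)
  have hf : Set.MapsTo f R.POS R.POS := by
    intro p hp
    by_cases hex : ∃ q, Cross R ps p q
    · obtain ⟨q, hq⟩ := hex
      rw [f_of_cross hq]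
      exact stations_subset_POS (next_of_cross hq).mem_stations
    · rwa [f_of_not (not_exists.1 hex)]
  obtain ⟨U, hU⟩ := T.exists_tok_map hf
  refine ⟨U, .sync l ps hl h (fun t p q ht hpq => by simp [hU, ht, f_of_cross hpq]) fun t ht => ?_⟩
  cases hp : T.tok t with
  | none => simp [hU, hp]
  | some p => simp [hU, hp, f_of_not fun q => ht p q hp]

/-- The positions through which the tokens of `T` have passed, provided that each of them has
followed `Next` from its origin. -/
def visited (T : R.State) : Set (Pos E) :=
  {x | ∃ s p, T.tok s = some p ∧ Relation.ReflTransGen R.Next s x ∧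
    Relation.ReflTransGen R.Next x p}

/-- The invariant of the machine: the tokens have followed `Next` from their origins, and have
crossed either all the wires of a sync link or none. -/
structure Coherent (T : R.State) : Prop where
  path : ∀ s p, T.tok s = some p → Relation.ReflTransGen R.Next s p
  sync : ∀ l ps p q p' q', R.link l = Link.sync ps → R.Via l p q → R.Via l p' q' →
    q ∈ T.visited → q' ∈ T.visited

theorem mem_image_or_exists_next (hx : x ∈ T.visited) :
    x ∈ T.image ∨ ∃ q ∈ T.visited, R.Next x q := by
  obtain ⟨s, p, hs, hsx, hxp⟩ := hx
  rcases hxp.cases_head with rfl | ⟨q, hxq, hqp⟩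
  · exact Or.inl ⟨s, hs⟩
  · exact Or.inr ⟨q, ⟨s, p, hs, hsx.tail hxq, hqp⟩, hxq⟩

theorem origin_unique {s' : Pos E} (hs : s ∈ R.origins) (hs' : s' ∈ R.origins)
    (h : Relation.ReflTransGen R.Next s x) (h' : Relation.ReflTransGen R.Next s' x) : s = s' :=
  eq_of_reflTransGen_of_initial R.next_left_unique h h' (fun _ => not_next_of_mem_origins hs)
    fun _ => not_next_of_mem_origins hs'

theorem exists_tok_of_visited (hs : s ∈ R.origins) (h : s ∈ T.visited) : ∃ p, T.tok s = some p := by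
  obtain ⟨s', p, hs', hs's, -⟩ := h
  obtain rfl := origin_unique (mem_origins_of_tok hs') hs hs's .refl
  exact ⟨p, hs'⟩

theorem visited_subset_stations (T : R.State) : T.visited ⊆ R.stations := by
  rintro x ⟨s, p, hs, hsx, -⟩
  rcases hsx.cases_tail with rfl | ⟨y, -, hyx⟩
  · exact origins_subset_stations (mem_origins_of_tok hs)
  · exact hyx.mem_stations

namespace Coherent

theorem image_subset_visited (hT : T.Coherent) : T.image ⊆ T.visited :=
  fun p ⟨s, hs⟩ => ⟨s, p, hs, hT.path s p hs, .refl⟩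

theorem mem_visited_of_tok (hT : T.Coherent) (hs : T.tok s = some p) : s ∈ T.visited :=
  ⟨s, p, hs, .refl, hT.path s p hs⟩

theorem mem_visited_of_next (hT : T.Coherent) (hpq : R.Next p q) (hq : q ∈ T.visited) :
    p ∈ T.visited ∧ p ∉ T.image := by
  obtain ⟨s, x, hs, hsq, hqx⟩ := hq
  have hsp : Relation.ReflTransGen R.Next s p := by
    rcases hsq.cases_tail with rfl | ⟨p', hsp', hp'q⟩
    · exact absurd hpq (not_next_of_mem_origins (mem_origins_of_tok hs))
    · rwa [R.next_left_unique hpq hp'q]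
  refine ⟨⟨s, x, hs, hsp, hqx.head hpq⟩, ?_⟩
  rintro ⟨s', hs'⟩
  obtain rfl :=
    origin_unique (mem_origins_of_tok hs) (mem_origins_of_tok hs') hsp (hT.path s' p hs')
  cases hs.symm.trans hs'
  exact not_transGen_self_of_initial R.next_left_unique hsp
    (fun _ => not_next_of_mem_origins (mem_origins_of_tok hs)) (.head' hpq hqx)

end Coherent

theorem coherent_initialState : R.initialState.Coherent where
  path s p h := by rw [(initialState_tok.1 h).2]
  sync l ps p q p' q' _ h _ hq := by
    obtain ⟨s, x, hs, hsq, hqx⟩ := hq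
    obtain ⟨hINIT, rfl⟩ := initialState_tok.1 hs
    rcases hqx.cases_tail with rfl | ⟨y, -, hy⟩
    · exact absurd ⟨l, h⟩ (not_next_of_mem_origins (Or.inl hINIT))
    · exact absurd hy (not_next_of_mem_origins (Or.inl hINIT))

theorem Step.visited_subset (h : Step T U) : T.visited ⊆ U.visited := by
  rintro x ⟨s, p, hs, hsx, hxp⟩
  rcases h.tok_of_some hs with hU | ⟨l, q, hvia, hU, -⟩
  · exact ⟨s, p, hU, hsx, hxp⟩
  · exact ⟨s, q, hU, hsx, hxp.tail ⟨l, hvia⟩⟩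

theorem Step.visited_subset_union (h : Step T U) : U.visited ⊆ T.visited ∪ U.image := by
  rintro x ⟨s, p, hs, hsx, hxp⟩
  rcases hxp.cases_tail with rfl | ⟨p', hxp', hp'p⟩
  · exact Or.inr ⟨s, hs⟩
  rcases h.cases_tok hs with hT | ⟨-, hones, rfl⟩ | ⟨l, p₀, hvia, hT, -⟩
  · exact Or.inl ⟨s, p, hT, hsx, hxp⟩
  · exact absurd hp'p (not_next_of_mem_origins (Or.inr hones))
  · obtain rfl := R.next_left_unique hp'p ⟨l, hvia⟩
    exact Or.inl ⟨s, p', hT, hsx, hxp'⟩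

theorem Coherent.step (hT : T.Coherent) (h : Step T U) : U.Coherent := by
  have path (s p) (hs : U.tok s = some p) : Relation.ReflTransGen R.Next s p := by
    rcases h.cases_tok hs with hTs | ⟨-, -, rfl⟩ | ⟨l, p₀, hvia, hTs, -⟩
    · exact hT.path s p hTs
    · exact .refl
    · exact (hT.path s p₀ hTs).tail ⟨l, hvia⟩
  refine ⟨path, fun l ps p q p' q' hl hpq hpq' hq => ?_⟩
  have visited_of_old (hq : q ∈ T.visited) : q' ∈ U.visited :=
    h.visited_subset (hT.sync l ps p q p' q' hl hpq hpq' hq)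
  rcases h.visited_subset_union hq with hq | ⟨t, ht⟩
  · exact visited_of_old hq
  rcases h.cases_tok ht with hTt | ⟨-, hones, rfl⟩ | ⟨k, p₀, hvia, -, hsync⟩
  · exact visited_of_old (hT.image_subset_visited ⟨t, hTt⟩)
  · exact absurd ⟨l, hpq⟩ (not_next_of_mem_origins (Or.inr hones))
  · obtain rfl := R.next_left_unique ⟨l, hpq⟩ ⟨k, hvia⟩
    obtain rfl := hpq.link_unique hvia
    obtain ⟨t', ht'⟩ := hsync ps p' q' hl hpq'
    exact ⟨t', q', ht', path t' q' ht', .refl⟩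

theorem exists_cross {ps : List (E × E)} (hl : R.link l = Link.sync ps) :
    ∃ p q, Cross R ps p q := by
  have hwt := R.wellTyped l
  rw [hl] at hwt
  obtain ⟨⟨a, c⟩, hac⟩ := List.exists_mem_of_ne_nil ps hwt.1
  obtain ⟨m, hm | hm⟩ := (R.ty a).exists_occ
  · exact ⟨_, _, .down a c m hac hm⟩
  · exact ⟨_, _, .up a c m hac (by rwa [← (hwt.2 _ hac).1])⟩

theorem Coherent.exists_fresh (hT : T.Coherent) (h : Step T U) : ∃ q ∈ U.image, q ∉ T.visited := by
  have fresh {p q : Pos E} (hpq : R.Next p q) (hp : p ∈ T.image) : q ∉ T.visited :=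
    fun hq => (hT.mem_visited_of_next hpq hq).2 hp
  cases h with
  | move s p q hs hmove hU _ =>
    obtain ⟨l, hvia, -⟩ := hmove.exists_via
    exact ⟨q, ⟨s, hU⟩, fresh ⟨l, hvia⟩ ⟨s, hs⟩⟩
  | sync l ps hl hsat hcross _ =>
    obtain ⟨p, q, hpq⟩ := exists_cross hl
    obtain ⟨s, hs⟩ := mem_image_of_cross hl hsat hpq
    exact ⟨q, ⟨s, hcross s p q hs hpq⟩, fresh ⟨l, (cross_iff_via hl).1 hpq⟩ ⟨s, hs⟩⟩
  | one l e hl _ hnone hU _ =>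
    refine ⟨_, ⟨_, hU⟩, fun hvis => ?_⟩
    obtain ⟨p, hp⟩ := exists_tok_of_visited (Or.inr ⟨l, e, hl, rfl⟩) hvis
    simp [hnone] at hp

theorem Coherent.visited_ssubset (hT : T.Coherent) (h : Step T U) : T.visited ⊂ U.visited := by
  obtain ⟨q, hqU, hqT⟩ := hT.exists_fresh h
  exact h.visited_subset.ssubset_of_mem_notMem ((hT.step h).image_subset_visited hqU) hqT

end State

end Structure

/-! ### Blame in nets -/

namespace Structure

variable {L E : Type} {R : Structure L E} {β : E → Blame} {l l' k : L} {r : Option L} {e : E}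

/-- The edge `e` is an edge of the link `l` on which `l` is to blame. -/
def Blames (R : Structure L E) (β : E → Blame) (l : L) (e : E) : Prop :=
  (e ∈ (R.link l).conclusions ∧ β e = Blame.source) ∨
    (e ∈ (R.link l).premisses ∧ β e = Blame.target)

/-- The edge `e` is an edge of the link `l` on which the link at the other end is to blame. -/
def Shifts (R : Structure L E) (β : E → Blame) (l : L) (e : E) : Prop :=
  (e ∈ (R.link l).premisses ∧ β e = Blame.source) ∨
    (e ∈ (R.link l).conclusions ∧ β e = Blame.target)

/-- The edge `e` is a way for the link `l` to pass the blame on to another link. A `par` link may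
use a premiss only if it is not itself to blame on the other premiss, since a switching path cannot
cross it from one premiss to the other. -/
def IsExit (R : Structure L E) (β : E → Blame) (l : L) (e : E) : Prop :=
  R.Shifts β l e ∧ ∀ a b c, R.link l = Link.par a b c → β e = Blame.source →
    β a ≠ Blame.target ∧ β b ≠ Blame.target

/-- Nobody is to blame on the lock of the box `r`; this always holds for the outermost level
`r = none`. -/
def IsOpen (R : Structure L E) (β : E → Blame) (r : Option L) : Prop :=
  ∀ b e ds, r = some b → R.link b = Link.box e ds → β e = Blame.nobody

/-- The conditions on the blames on the edges that hold if they come from a stuck state of the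
machine. -/
structure IsBlame (R : Structure L E) (β : E → Blame) : Prop where
  ne_target_of_isPositive : ∀ e, (R.ty e).IsPositive → β e ≠ Blame.target
  ne_source_of_isNegative : ∀ e, (R.ty e).IsNegative → β e ≠ Blame.source
  conclusion : ∀ e, R.IsConclusion e → β e ≠ Blame.target
  ax : ∀ l e f, R.link l = Link.ax e f → β f = (β e).flip
  cut : ∀ l e f, R.link l = Link.cut e f → β f = (β e).flip
  tensor : ∀ l a b c, R.link l = Link.tensor a b c → β c = (β a).tensor (β b)
  par : ∀ l a b c, R.link l = Link.par a b c → β c = (β a).par (β b)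
  one : ∀ l e, R.link l = Link.one e → R.IsOpen β (R.boxOf l) → β e = Blame.nobody
  sync : ∀ l ps e, R.link l = Link.sync ps → R.Blames β l e → ∃ e', R.Shifts β l e'
  door : ∀ l e ds d c, R.link l = Link.box e ds → β e = Blame.nobody → (d, c) ∈ ds → β d = β c

theorem Shifts.joins (h : R.Shifts β l e) (h' : R.Blames β l' e) : R.Joins e l l' := by
  rcases h with ⟨hl, hβ⟩ | ⟨hl, hβ⟩ <;> rcases h' with ⟨hl', hβ'⟩ | ⟨hl', hβ'⟩
  · exact Or.inr ⟨hl', hl⟩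
  · simp [hβ] at hβ'
  · simp [hβ] at hβ'
  · exact Or.inl ⟨hl, hl'⟩

theorem Shifts.link_unique (h : R.Shifts β l e) (h' : R.Shifts β l' e) : l = l' := by
  rcases h with ⟨hl, hβ⟩ | ⟨hl, hβ⟩ <;> rcases h' with ⟨hl', hβ'⟩ | ⟨hl', hβ'⟩
  · exact R.target e l l' hl hl'
  · simp [hβ] at hβ'
  · simp [hβ] at hβ'
  · exact source_unique hl hl'

theorem Blames.link_unique (h : R.Blames β l e) (h' : R.Blames β l' e) : l = l' := by
  rcases h with ⟨hl, hβ⟩ | ⟨hl, hβ⟩ <;> rcases h' with ⟨hl', hβ'⟩ | ⟨hl', hβ'⟩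
  · exact source_unique hl hl'
  · simp [hβ] at hβ'
  · simp [hβ] at hβ'
  · exact R.target e l l' hl hl'

theorem Joins.boxOf_eq (h : R.Joins e l l') : R.boxOf l = R.boxOf l' :=
  h.elim (fun h => R.premiss_level e l l' h.1 h.2) fun h => (R.premiss_level e l' l h.1 h.2).symm

theorem Shifts.source_or_target (h : R.Shifts β l e) : β e = Blame.source ∨ β e = Blame.target :=
  h.imp And.right And.right

theorem IsBlame.blames_of_outEdge (hβ : R.IsBlame β) {ps : List (E × E)}
    (hk : R.link k = Link.sync ps) (he : Link.OutEdge R.ty ps e)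
    (h : β e = Blame.source ∨ β e = Blame.target) : R.Blames β k e := by
  obtain ⟨p, hp, ⟨hpos, rfl⟩ | ⟨hneg, rfl⟩⟩ := he
  · exact Or.inl ⟨by rw [hk]; exact List.mem_map_of_mem hp,
      h.resolve_right (hβ.ne_target_of_isPositive _ hpos)⟩
  · exact Or.inr ⟨by rw [hk]; exact List.mem_map_of_mem hp,
      h.resolve_left (hβ.ne_source_of_isNegative _ hneg)⟩

theorem IsBlame.isSwitchingCycle (hβ : R.IsBlame β) {n : ℕ} {v : Fin (n + 1) → L}
    {d : Fin (n + 1) → E} (hr : ∀ i, R.boxOf (v i) = r) (hv : Function.Injective v)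
    (hexit : ∀ i, R.IsExit β (v i) (d i)) (hblames : ∀ i, R.Blames β (v (i + 1)) (d i)) :
    R.IsSwitchingCycle r n v d where
  level := hr
  links_injective := hv
  edges_injective i j hij := hv ((hexit i).1.link_unique (hij ▸ (hexit j).1))
  joins i := (hexit i).1.joins (hblames i)
  par := by
    rintro l a b c hl ⟨⟨i, rfl⟩, ⟨j, rfl⟩⟩
    have hne : d i ≠ d j := by
      have hnd := R.premisses_nodup l
      rw [hl] at hnd
      simpa [Link.premisses] using hnd
    have hi : d i ∈ (R.link l).premisses := by simp [hl, Link.premisses]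
    have hj : d j ∈ (R.link l).premisses := by simp [hl, Link.premisses]
    have eq_of_source {i} (hi : d i ∈ (R.link l).premisses) (h : β (d i) = Blame.source) :
        v i = l := (hexit i).1.link_unique (Or.inl ⟨hi, h⟩)
    have eq_of_target {i} (hi : d i ∈ (R.link l).premisses) (h : β (d i) = Blame.target) :
        v (i + 1) = l := (hblames i).link_unique (Or.inr ⟨hi, h⟩)
    rcases (hexit i).1.source_or_target with hβi | hβi <;>
      rcases (hexit j).1.source_or_target with hβj | hβj
    · exact hne (congrArg d (hv ((eq_of_source hi hβi).trans (eq_of_source hj hβj).symm)))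
    · exact ((hexit i).2 _ _ _ ((eq_of_source hi hβi).symm ▸ hl) hβi).2 hβj
    · exact ((hexit j).2 _ _ _ ((eq_of_source hj hβj).symm ▸ hl) hβj).1 hβi
    · have hij := hv ((eq_of_target hi hβi).trans (eq_of_target hj hβj).symm)
      exact hne (congrArg d (add_right_cancel hij))
  sync := by
    rintro l ps hl _ _ ho ho' ⟨i, rfl⟩ ⟨j, rfl⟩
    have hi := (hblames i).link_unique (hβ.blames_of_outEdge hl ho (hexit i).1.source_or_target)
    have hj := (hblames j).link_unique (hβ.blames_of_outEdge hl ho' (hexit j).1.source_or_target)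
    exact congrArg d (add_right_cancel (hv (hi.trans hj.symm)))

theorem IsNet.not_forall_exists_isExit [Finite L] (hR : R.IsNet) (hβ : R.IsBlame β) {P : Set L}
    (hP : P.Nonempty) (hr : ∀ l ∈ P, R.boxOf l = r) :
    ¬ ∀ l ∈ P, ∃ e, R.IsExit β l e ∧ ∃ l' ∈ P, R.Blames β l' e := by
  intro h
  choose d hexit f hf hblames using fun l : P => h l l.2
  have : Nonempty P := hP.to_subtype
  obtain ⟨n, v, hv, hvf⟩ := exists_injective_cycle fun l : P => (⟨f l, hf l⟩ : P)
  refine hR r n (fun i => v i) (fun i => d (v i)) (hβ.isSwitchingCycle (fun i => hr _ (v i).2)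
    (Subtype.val_injective.comp hv) (fun i => hexit (v i)) fun i => ?_)
  rw [hvf]
  exact hblames (v i)

/-- The edges at depth `0` of the content of the box `r`, or of the whole structure. -/
def AtLevel (R : Structure L E) (r : Option L) (e : E) : Prop :=
  ∃ l, R.boxOf l = r ∧ e ∈ (R.link l).conclusions

/-- The conclusions of the content of the box `r`, or of the whole structure. -/
def IsPending (R : Structure L E) (r : Option L) (e : E) : Prop :=
  R.AtLevel r e ∧ ∀ l, e ∉ (R.link l).premisses

/-- The claim to be proved by induction on the nesting of boxes: nobody is to blame on the edges of
the content of the box `r`, provided that the box is open and that the blame on the conclusions of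
the content does not lie outside of it. -/
def LevelClears (R : Structure L E) (β : E → Blame) (r : Option L) : Prop :=
  R.IsOpen β r → (∀ e, R.IsPending r e → β e ≠ Blame.target) →
    ∀ e, R.AtLevel r e → β e = Blame.nobody

theorem exists_door_of_isPending {b : L} (h : R.IsPending (some b) e) :
    ∃ a ds c, R.link b = Link.box a ds ∧ (e, c) ∈ ds := by
  obtain ⟨k, hk, -⟩ := h.1
  obtain ⟨a, ds, hb⟩ := R.boxOf_isBox k b hk
  have hinner := (R.inner_iff b e).2 h
  rw [hb] at hinner
  obtain ⟨⟨_, c⟩, hec, rfl⟩ := List.mem_map.1 hinner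
  exact ⟨a, ds, c, hb, hec⟩

theorem isPending_of_door {a d c : E} {ds : List (E × E)} (hl : R.link l = Link.box a ds)
    (h : (d, c) ∈ ds) : R.IsPending (some l) d :=
  (R.inner_iff l d).1 (by rw [hl]; exact List.mem_map.2 ⟨_, h, rfl⟩)

namespace IsBlame

theorem eq_nobody_of_box (hβ : R.IsBlame β) {a : E} {ds : List (E × E)}
    (hl : R.link l = Link.box a ds) (hbox : R.LevelClears β (some l))
    (h : ∀ c ∈ (R.link l).conclusions, β c ≠ Blame.target) :
    ∀ c ∈ (R.link l).conclusions, β c = Blame.nobody := by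
  have hlock : β a = Blame.nobody := by
    have hsource := hβ.ne_source_of_isNegative a (by rw [ty_lock hl]; trivial)
    have htarget := h a (mem_conclusions_lock hl)
    cases hβa : β a <;> simp_all
  have hclear : ∀ d, R.AtLevel (some l) d → β d = Blame.nobody := by
    refine hbox (fun b a' ds' hb hl' => ?_) fun d hd => ?_
    · cases hb
      cases hl.symm.trans hl'
      exact hlock
    · obtain ⟨a', ds', c, hl', hdc⟩ := exists_door_of_isPending hd
      cases hl.symm.trans hl'
      rw [hβ.door l a ds d c hl hlock hdc]
      exact h c (by rw [hl]; exact List.mem_cons_of_mem _ (List.mem_map_of_mem hdc))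
  intro c hc
  rw [hl] at hc
  rcases List.mem_cons.1 hc with rfl | hc
  · exact hlock
  · obtain ⟨⟨d, _⟩, hdc, rfl⟩ := List.mem_map.1 hc
    rw [← hβ.door l a ds d _ hl hlock hdc]
    exact hclear d (isPending_of_door hl hdc).1

theorem exists_shifts_of_ax (hβ : R.IsBlame β) {f g : E} (hl : R.link l = Link.ax f g)
    (h : R.Blames β l e) : ∃ e', R.Shifts β l e' := by
  have hfg := hβ.ax l f g hl
  simp only [Blames, Shifts, hl, Link.conclusions, Link.premisses] at h ⊢
  cases hβf : β f <;> grind [Blame.flip]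

theorem exists_shifts_of_cut (hβ : R.IsBlame β) {f g : E} (hl : R.link l = Link.cut f g)
    (h : R.Blames β l e) : ∃ e', R.Shifts β l e' := by
  have hfg := hβ.cut l f g hl
  simp only [Blames, Shifts, hl, Link.conclusions, Link.premisses] at h ⊢
  cases hβf : β f <;> grind [Blame.flip]

theorem exists_shifts_of_tensor (hβ : R.IsBlame β) {a b c : E} (hl : R.link l = Link.tensor a b c)
    (h : R.Blames β l e) : ∃ e', R.Shifts β l e' := by
  have hc := hβ.tensor l a b c hl
  simp only [Blames, Shifts, hl, Link.conclusions, Link.premisses] at h ⊢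
  cases hβa : β a <;> cases hβb : β b <;> grind [Blame.tensor]

theorem exists_isExit_of_par (hβ : R.IsBlame β) {a b c : E} (hl : R.link l = Link.par a b c)
    (h : R.Blames β l e) : ∃ e', R.IsExit β l e' := by
  have hc := hβ.par l a b c hl
  by_cases ht : β c = Blame.target
  · exact ⟨c, Or.inr ⟨by simp [hl, Link.conclusions], ht⟩, by simp [ht]⟩
  have hab : β a ≠ Blame.target ∧ β b ≠ Blame.target := by
    rwa [hc, Blame.par_eq_target, not_or] at ht
  have hs : β c = Blame.source := by
    simp only [Blames, hl, Link.conclusions, Link.premisses] at h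
    grind
  have isExit {x : E} (hx : x ∈ (R.link l).premisses) (hs : β x = Blame.source) :
      R.IsExit β l x := by
    refine ⟨Or.inl ⟨hx, hs⟩, fun a' b' c' hl' _ => ?_⟩
    cases hl.symm.trans hl'
    exact hab
  rcases Blame.eq_source_of_par_eq_source (hc.symm.trans hs) with ha | hb
  · exact ⟨a, isExit (by simp [hl, Link.premisses]) ha⟩
  · exact ⟨b, isExit (by simp [hl, Link.premisses]) hb⟩

theorem exists_isExit (hβ : R.IsBlame β) (hopen : R.IsOpen β (R.boxOf l))
    (hbox : R.LevelClears β (some l)) (h : R.Blames β l e) : ∃ e', R.IsExit β l e' := by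
  have isExit (hpar : ∀ a b c, R.link l ≠ Link.par a b c) :
      (∃ e', R.Shifts β l e') → ∃ e', R.IsExit β l e' :=
    Exists.imp fun e' h => ⟨h, fun a b c hl => absurd hl (hpar a b c)⟩
  cases hl : R.link l with
  | ax f g => exact isExit (by simp [hl]) (hβ.exists_shifts_of_ax hl h)
  | cut f g => exact isExit (by simp [hl]) (hβ.exists_shifts_of_cut hl h)
  | tensor a b c => exact isExit (by simp [hl]) (hβ.exists_shifts_of_tensor hl h)
  | par a b c => exact hβ.exists_isExit_of_par hl h
  | one f =>
    have hf := hβ.one l f hl hopen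
    simp only [Blames, hl, Link.conclusions, Link.premisses] at h
    grind
  | sync ps => exact isExit (by simp [hl]) (hβ.sync l ps e hl h)
  | box a ds =>
    by_contra! hno
    have hclear := hβ.eq_nobody_of_box hl hbox fun c hc ht =>
      hno c ⟨Or.inr ⟨hc, ht⟩, by simp [hl]⟩
    rcases h with ⟨he, hs⟩ | ⟨he, -⟩
    · simp [hclear e he] at hs
    · simp [hl, Link.premisses] at he

theorem levelClears_of_boxes [Finite L] (hβ : R.IsBlame β) (hR : R.IsNet)
    (hbox : ∀ l, R.boxOf l = r → R.LevelClears β (some l)) : R.LevelClears β r := by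
  intro hopen hpending
  have exists_blames {e : E} (he : R.AtLevel r e) (ht : β e = Blame.target) :
      ∃ l, R.Blames β l e := by
    by_contra! h
    exact hpending e ⟨he, fun l hl => h l (Or.inr ⟨hl, ht⟩)⟩ ht
  have exists_next {l : L} {e : E} (hl : R.boxOf l = r) (he : R.Shifts β l e) :
      ∃ l', R.Blames β l' e := by
    rcases he with ⟨-, hs⟩ | ⟨he, ht⟩
    · obtain ⟨l', hl', -⟩ := R.source e
      exact ⟨l', Or.inl ⟨hl', hs⟩⟩
    · exact exists_blames ⟨l, hl, he⟩ ht
  have not_blames (l : L) (e : E) (hl : R.boxOf l = r) : ¬ R.Blames β l e := by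
    intro he
    refine hR.not_forall_exists_isExit hβ (P := {l | R.boxOf l = r ∧ ∃ e, R.Blames β l e})
      ⟨l, hl, e, he⟩ (fun l hl => hl.1) ?_
    rintro l ⟨hl, e, he⟩
    obtain ⟨e', hexit⟩ := hβ.exists_isExit (hl ▸ hopen) (hbox l hl) he
    obtain ⟨l', hl'⟩ := exists_next hl hexit.1
    exact ⟨e', hexit, l', ⟨(hexit.1.joins hl').boxOf_eq.symm.trans hl, e', hl'⟩, hl'⟩
  intro e he
  cases hβe : β e with
  | nobody => rfl
  | source =>
    obtain ⟨l, hl, hel⟩ := he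
    exact absurd (Or.inl ⟨hel, hβe⟩) (not_blames l e hl)
  | target =>
    obtain ⟨l', hl'⟩ := exists_blames he hβe
    obtain ⟨l, hl, hel⟩ := he
    have hjoins : R.Joins e l l' := Shifts.joins (Or.inr ⟨hel, hβe⟩) hl'
    exact absurd hl' (not_blames l' e (hjoins.boxOf_eq.symm.trans hl))

theorem levelClears [Finite L] (hβ : R.IsBlame β) (hR : R.IsNet) (r : Option L) :
    R.LevelClears β r := by
  have hwf : WellFounded fun k b => R.boxOf k = some b :=
    wellFounded_of_forall_not_transGen R.boxOf_acyclic
  have hsome (b : L) : R.LevelClears β (some b) :=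
    hwf.induction b fun _ => hβ.levelClears_of_boxes hR
  exact hβ.levelClears_of_boxes hR fun l _ => hsome l

theorem eq_nobody_of_atLevel [Finite L] (hβ : R.IsBlame β) (hR : R.IsNet) (r : Option L) :
    ∀ e, R.AtLevel r e → β e = Blame.nobody := by
  have hnone : ∀ e, R.AtLevel none e → β e = Blame.nobody :=
    hβ.levelClears hR none (fun _ _ _ h => by cases h) hβ.conclusion
  have hwf : WellFounded fun b k => R.boxOf k = some b :=
    wellFounded_of_forall_not_transGen fun b h => R.boxOf_acyclic b (Relation.transGen_swap.1 h)
  cases r with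
  | none => exact hnone
  | some b =>
    induction b using hwf.induction with
    | _ b ih =>
      have hout (e) (he : e ∈ (R.link b).conclusions) : β e = Blame.nobody := by
        cases hb : R.boxOf b with
        | none => exact hnone e ⟨b, hb, he⟩
        | some b' => exact ih b' hb e ⟨b, hb, he⟩
      refine hβ.levelClears hR (some b) (fun b' a ds hb hl => ?_) fun e he => ?_
      · cases hb
        exact hout a (mem_conclusions_lock hl)
      · obtain ⟨a, ds, c, hl, hec⟩ := exists_door_of_isPending he
        rw [hβ.door b a ds e c hl (hout a (mem_conclusions_lock hl)) hec,
          hout c (by rw [hl]; exact List.mem_cons_of_mem _ (List.mem_map_of_mem hec))]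
        simp

theorem eq_nobody [Finite L] (hβ : R.IsBlame β) (hR : R.IsNet) (e : E) : β e = Blame.nobody := by
  obtain ⟨l, hl, -⟩ := R.source e
  exact hβ.eq_nobody_of_atLevel hR (R.boxOf l) e ⟨l, rfl, hl⟩

end IsBlame

end Structure

/-! ### Stuck states -/

namespace Structure

namespace State

variable {L E : Type} {R : Structure L E} {T U : R.State} {l : L} {p q s : Pos E} {π ρ : Port E}
  {a b c e f : E} {m : List Dir} {ps ds : List (E × E)}

/-- No transition starts in the state. -/
def IsStuck (T : R.State) : Prop :=
  ∀ U, ¬ Step T U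

/-- The blame on the edge `e` for the positions of `e` that have not been visited. -/
noncomputable def blame (T : R.State) (e : E) : Blame :=
  (R.ty e).blame fun m => Pos.atom e m ∈ T.visited

theorem blame_eq_nobody_iff :
    T.blame e = Blame.nobody ↔ ∀ m, (R.ty e).Occ m → Pos.atom e m ∈ T.visited :=
  Formula.blame_eq_nobody_iff

theorem exists_posOcc_of_blame_eq_source (h : T.blame e = Blame.source) :
    ∃ m, (R.ty e).PosOcc m ∧ Pos.atom e m ∉ T.visited := by
  by_contra! hc
  exact Formula.blame_ne_source hc h

theorem exists_negOcc_of_blame_eq_target (h : T.blame e = Blame.target) :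
    ∃ m, (R.ty e).NegOcc m ∧ Pos.atom e m ∉ T.visited := by
  by_contra! hc
  exact Formula.blame_ne_target hc h

theorem exists_cross_of_blames (hl : R.link l = Link.sync ps) (h : R.Blames T.blame l e) :
    ∃ p q, Cross R ps p q ∧ q ∉ T.visited := by
  have hwt := R.wellTyped l
  rw [hl] at hwt
  rcases h with ⟨he, hs⟩ | ⟨he, ht⟩ <;> rw [hl] at he <;>
    obtain ⟨⟨a, c⟩, hac, rfl⟩ := List.mem_map.1 he
  · obtain ⟨m, hm, hv⟩ := exists_posOcc_of_blame_eq_source hs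
    have hty : R.ty a = R.ty c := (hwt.2 _ hac).1
    exact ⟨_, _, .down a c m hac (by rwa [hty]), hv⟩
  · obtain ⟨m, hm, hv⟩ := exists_negOcc_of_blame_eq_target ht
    have hty : R.ty a = R.ty c := (hwt.2 _ hac).1
    exact ⟨_, _, .up a c m hac (by rwa [← hty]), hv⟩

theorem exists_shifts_of_cross (hl : R.link l = Link.sync ps) (h : Cross R ps p q)
    (hp : p ∉ T.visited) : ∃ e, R.Shifts T.blame l e := by
  have hwt := R.wellTyped l
  rw [hl] at hwt
  have ne_nobody {e : E} {m : List Dir} (hm : (R.ty e).Occ m) (he : Pos.atom e m ∉ T.visited) :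
      T.blame e ≠ Blame.nobody := fun h => he (blame_eq_nobody_iff.1 h m hm)
  cases h with
  | down a c m hac hm =>
    have hneg : ∀ m, ¬ (R.ty a).NegOcc m :=
      ((hwt.2 _ hac).2.resolve_right fun hn => hn.not_posOcc m hm).not_negOcc
    refine ⟨a, Or.inl ⟨by rw [hl]; exact List.mem_map.2 ⟨_, hac, rfl⟩, ?_⟩⟩
    cases hβ : T.blame a with
    | source => rfl
    | nobody => exact absurd hβ (ne_nobody (Or.inl hm) hp)
    | target => exact absurd hβ (Formula.blame_ne_target fun m hm => absurd hm (hneg m))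
  | up a c m hac hm =>
    have hty : R.ty a = R.ty c := (hwt.2 _ hac).1
    have hpos : ∀ m, ¬ (R.ty c).PosOcc m :=
      ((hty ▸ (hwt.2 _ hac).2).resolve_left fun hn => hn.not_negOcc m hm).not_posOcc
    refine ⟨c, Or.inr ⟨by rw [hl]; exact List.mem_map.2 ⟨_, hac, rfl⟩, ?_⟩⟩
    cases hβ : T.blame c with
    | target => rfl
    | nobody => exact absurd hβ (ne_nobody (Or.inr hm) hp)
    | source => exact absurd hβ (Formula.blame_ne_source fun m hm => absurd hm (hpos m))

theorem IsStuck.unlocked (hS : T.IsStuck) (hl : R.link l = Link.box e ds)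
    (he : T.blame e = Blame.nobody) : T.Unlocked l := by
  have hvis : Pos.atom e [] ∈ T.visited :=
    blame_eq_nobody_iff.1 he [] (by rw [ty_lock hl, Formula.occ_bot])
  rcases mem_image_or_exists_next hvis with ⟨s, hs⟩ | ⟨q, hq, hnext⟩
  · obtain ⟨U, hU⟩ := exists_step_of_move hs (.unlock l e ds hl)
    exact absurd hU (hS U)
  · obtain rfl := R.next_right_unique hnext ⟨l, .unlock e ds hl rfl rfl⟩
    have himage := (mem_image_or_exists_next hq).resolve_right fun ⟨_, _, h⟩ => not_next_lock h
    exact ⟨e, ds, 0, hl, himage⟩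

theorem IsStuck.active (hS : T.IsStuck) (h : R.IsOpen T.blame (R.boxOf l)) :
    T.Active l := by
  cases hb : R.boxOf l with
  | none => exact Or.inl hb
  | some b =>
    obtain ⟨e, ds, hl⟩ := R.boxOf_isBox l b hb
    exact Or.inr ⟨b, hb, hS.unlocked hl (h b e ds hb hl)⟩

namespace Coherent

theorem mem_visited_iff_of_incoming (hT : T.Coherent) (hS : T.IsStuck)
    (hj : (R.link l).Joined π ρ) (hπ : π.Incoming R.ty) (hsync : ∀ ps, R.link l ≠ Link.sync ps)
    (hbox : (R.link l).IsBox → T.Unlocked l) : π.pos ∈ T.visited ↔ ρ.pos ∈ T.visited := by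
  have hnext : R.Next π.pos ρ.pos := ⟨l, .wire π ρ hj hπ rfl rfl⟩
  refine ⟨fun h => ?_, fun h => (hT.mem_visited_of_next hnext h).1⟩
  rcases mem_image_or_exists_next h with ⟨s, hs⟩ | ⟨q, hq, hπq⟩
  · obtain ⟨U, hU⟩ := exists_step_of_move hs (move_of_joined hj hπ hsync hbox)
    exact absurd hU (hS U)
  · rwa [R.next_right_unique hnext hπq]

theorem mem_visited_iff_of_joined (hT : T.Coherent) (hS : T.IsStuck) {k : Link E}
    (hl : R.link l = k) (hj : k.Joined π ρ) (hπ : π.Incoming R.ty ∨ π.Outgoing R.ty)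
    (hsync : ∀ ps, k ≠ Link.sync ps) (hbox : k.IsBox → T.Unlocked l) :
    π.pos ∈ T.visited ↔ ρ.pos ∈ T.visited := by
  subst hl
  rcases hπ with hπ | hπ
  · exact hT.mem_visited_iff_of_incoming hS hj hπ hsync hbox
  · exact (hT.mem_visited_iff_of_incoming hS hj.symm
      ((hj.symm.incoming_iff (R.wellTyped l)).2 hπ) hsync hbox).symm

theorem blame_ax (hT : T.Coherent) (hS : T.IsStuck) (hl : R.link l = Link.ax e f) :
    T.blame f = (T.blame e).flip := by
  have hty := R.wellTyped l
  rw [hl] at hty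
  rw [blame, show R.ty f = _ from hty, Formula.blame_dual]
  exact congrArg _ (Formula.blame_congr fun m hm => (hT.mem_visited_iff_of_joined hS hl
    (Or.inl (.ax e f m)) hm.symm (by simp) (by simp [Link.IsBox])).symm)

theorem blame_cut (hT : T.Coherent) (hS : T.IsStuck) (hl : R.link l = Link.cut e f) :
    T.blame f = (T.blame e).flip := by
  have hty := R.wellTyped l
  rw [hl] at hty
  rw [blame, show R.ty f = _ from hty, Formula.blame_dual]
  exact congrArg _ (Formula.blame_congr fun m hm => (hT.mem_visited_iff_of_joined hS hl
    (Or.inl (.cut e f m)) hm (by simp) (by simp [Link.IsBox])).symm)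

theorem blame_tensor (hT : T.Coherent) (hS : T.IsStuck) (hl : R.link l = Link.tensor a b c) :
    T.blame c = (T.blame a).tensor (T.blame b) := by
  have hty := R.wellTyped l
  rw [hl] at hty
  rw [blame, show R.ty c = _ from hty]
  exact congrArg₂ Blame.tensor
    (Formula.blame_congr fun m hm => (hT.mem_visited_iff_of_joined hS hl
      (Or.inl (.tensor_left a b c m)) hm (by simp) (by simp [Link.IsBox])).symm)
    (Formula.blame_congr fun m hm => (hT.mem_visited_iff_of_joined hS hl
      (Or.inl (.tensor_right a b c m)) hm (by simp) (by simp [Link.IsBox])).symm)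

theorem blame_par (hT : T.Coherent) (hS : T.IsStuck) (hl : R.link l = Link.par a b c) :
    T.blame c = (T.blame a).par (T.blame b) := by
  have hty := R.wellTyped l
  rw [hl] at hty
  rw [blame, show R.ty c = _ from hty]
  exact congrArg₂ Blame.par
    (Formula.blame_congr fun m hm => (hT.mem_visited_iff_of_joined hS hl
      (Or.inl (.par_left a b c m)) hm (by simp) (by simp [Link.IsBox])).symm)
    (Formula.blame_congr fun m hm => (hT.mem_visited_iff_of_joined hS hl
      (Or.inl (.par_right a b c m)) hm (by simp) (by simp [Link.IsBox])).symm)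

theorem blame_door (hT : T.Coherent) (hS : T.IsStuck) {d : E} (hl : R.link l = Link.box e ds)
    (he : T.blame e = Blame.nobody) (hdc : (d, c) ∈ ds) : T.blame d = T.blame c := by
  have hty := R.wellTyped l
  rw [hl] at hty
  rw [blame, blame, show R.ty d = R.ty c from hty.2 _ hdc]
  exact Formula.blame_congr fun m hm => (hT.mem_visited_iff_of_joined hS hl
    (Or.inr (.door e ds d c m hdc)) hm.symm (by simp) fun _ => hS.unlocked hl he).symm

theorem blame_one (hT : T.Coherent) (hS : T.IsStuck) (hl : R.link l = Link.one e)
    (h : R.IsOpen T.blame (R.boxOf l)) : T.blame e = Blame.nobody := by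
  refine blame_eq_nobody_iff.2 fun m hm => ?_
  rw [ty_one hl, Formula.occ_one] at hm
  subst hm
  cases htok : T.tok (Pos.atom e []) with
  | none =>
    obtain ⟨U, hU⟩ := exists_step_of_one hl (hS.active h) htok
    exact absurd hU (hS U)
  | some p => exact hT.mem_visited_of_tok htok

theorem exists_cross_not_visited (hT : T.Coherent) (hS : T.IsStuck)
    (hl : R.link l = Link.sync ps) (h : Cross R ps p q) (hq : q ∉ T.visited) :
    ∃ p' q', Cross R ps p' q' ∧ p' ∉ T.visited := by
  by_contra! hc
  have hwt := R.wellTyped l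
  rw [hl] at hwt
  have mem_image {p' q' : Pos E} (h' : Cross R ps p' q') : p' ∈ T.image := by
    refine (mem_image_or_exists_next (hc p' q' h')).resolve_right ?_
    rintro ⟨q₁, hq₁, hnext⟩
    obtain rfl := R.next_right_unique hnext ⟨l, (cross_iff_via hl).1 h'⟩
    exact hq (hT.sync l ps p' q₁ p q hl ((cross_iff_via hl).1 h') ((cross_iff_via hl).1 h) hq₁)
  obtain ⟨U, hU⟩ : ∃ U, Step T U := by
    refine exists_step_of_sync hl ?_
    rintro _ ⟨⟨a, c⟩, hac, ⟨hpos, rfl⟩ | ⟨hneg, rfl⟩⟩ m hm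
    · exact mem_image (.down _ _ m hac (hm.resolve_right (hpos.not_negOcc m)))
    · exact mem_image (.up _ _ m hac (hm.resolve_left (hneg.not_posOcc m)))
  exact hS U hU

theorem exists_shifts_of_sync (hT : T.Coherent) (hS : T.IsStuck) (hl : R.link l = Link.sync ps)
    (h : R.Blames T.blame l e) : ∃ e', R.Shifts T.blame l e' := by
  obtain ⟨p, q, hpq, hq⟩ := exists_cross_of_blames hl h
  obtain ⟨p', q', hpq', hp'⟩ := hT.exists_cross_not_visited hS hl hpq hq
  exact exists_shifts_of_cross hl hpq' hp'

theorem isBlame (hT : T.Coherent) (hS : T.IsStuck) : R.IsBlame T.blame where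
  ne_target_of_isPositive _ he :=
    Formula.blame_ne_target fun m hm => absurd hm (he.not_negOcc m)
  ne_source_of_isNegative _ he :=
    Formula.blame_ne_source fun m hm => absurd hm (he.not_posOcc m)
  conclusion e he := Formula.blame_ne_target fun m hm =>
    let ⟨_, hp⟩ := T.exists_tok_of_mem_INIT ⟨e, m, he, hm, rfl⟩
    hT.mem_visited_of_tok hp
  ax _ _ _ := hT.blame_ax hS
  cut _ _ _ := hT.blame_cut hS
  tensor _ _ _ _ := hT.blame_tensor hS
  par _ _ _ _ := hT.blame_par hS
  one _ _ := hT.blame_one hS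
  sync _ _ _ := hT.exists_shifts_of_sync hS
  door _ _ _ _ _ := hT.blame_door hS

variable [Finite L]

theorem mem_visited_of_occ (hT : T.Coherent) (hS : T.IsStuck) (hR : R.IsNet)
    (hm : (R.ty e).Occ m) : Pos.atom e m ∈ T.visited :=
  blame_eq_nobody_iff.1 ((hT.isBlame hS).eq_nobody hR e) m hm

theorem not_next_of_mem_image (hT : T.Coherent) (hS : T.IsStuck) (hR : R.IsNet)
    (hp : p ∈ T.image) : ¬ R.Next p q := by
  intro hpq
  obtain ⟨e, m, hm, rfl⟩ | ⟨e, -, rfl⟩ := hpq.mem_stations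
  · exact (hT.mem_visited_of_next hpq (hT.mem_visited_of_occ hS hR hm)).2 hp
  · obtain ⟨l, ⟨_, ρ, -, -, -, hpos⟩ | ⟨e', ds, hl, rfl, -⟩⟩ := hpq
    · cases ρ <;> cases hpos
    · obtain ⟨s, hs⟩ := hp
      obtain ⟨U, hU⟩ := exists_step_of_move hs (.unlock l e' ds hl)
      exact hS U hU

theorem isFinal (hT : T.Coherent) (hS : T.IsStuck) (hR : R.IsNet) : T.IsFinal := by
  refine ⟨T.image ∩ R.BOTBOX, Set.inter_subset_right, Set.Subset.antisymm ?_
    (Set.union_subset ?_ Set.inter_subset_left)⟩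
  · rintro p hp
    obtain ⟨s, hs⟩ := hp
    rcases T.pos s p hs with ⟨e, m, hm, rfl⟩ | hbot
    · exact Or.inl ((mem_FIN_or_exists_next hm).resolve_right fun ⟨q, hq⟩ =>
        hT.not_next_of_mem_image hS hR ⟨s, hs⟩ hq)
    · exact Or.inr ⟨⟨s, hs⟩, hbot⟩
  · intro p hp
    have hvis : p ∈ T.visited := by
      obtain ⟨e, m, -, hm, rfl⟩ := hp
      exact hT.mem_visited_of_occ hS hR (Or.inl hm)
    exact (mem_image_or_exists_next hvis).resolve_right fun ⟨q, _, hq⟩ => not_next_of_mem_FIN hp hq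

theorem tok_iff (hT : T.Coherent) (hS : T.IsStuck) (hR : R.IsNet) :
    T.tok s = some p ↔
      s ∈ R.origins ∧ Relation.ReflTransGen R.Next s p ∧ ∀ q, ¬ R.Next p q := by
  refine ⟨fun h => ⟨mem_origins_of_tok h, hT.path s p h,
    fun _ => hT.not_next_of_mem_image hS hR ⟨s, h⟩⟩, fun ⟨hs, hsp, hp⟩ => ?_⟩
  have hvis : s ∈ T.visited := by
    obtain ⟨e, m, hm, rfl⟩ := exists_atom_of_mem_origins hs
    exact hT.mem_visited_of_occ hS hR hm
  obtain ⟨p', hp'⟩ := exists_tok_of_visited hs hvis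
  rwa [eq_of_reflTransGen_of_terminal R.next_right_unique hsp (hT.path s p' hp') hp
    fun _ => hT.not_next_of_mem_image hS hR ⟨s, hp'⟩]

theorem eq_of_isStuck (hT : T.Coherent) (hS : T.IsStuck) (hU : U.Coherent) (hUS : U.IsStuck)
    (hR : R.IsNet) : T = U :=
  State.ext <| funext fun s => Option.ext fun p => by
    rw [hT.tok_iff hS hR, hU.tok_iff hUS hR]

end Coherent

end State

end Structure

/-! ### Runs -/

namespace Structure

variable {L E : Type} {R : Structure L E} {N : ℕ∞} {τ : ℕ → R.State} {n : ℕ}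

theorem exists_isRun (R : Structure L E) : ∃ N τ, R.IsRun N τ := by
  classical
  let next (T : R.State) : R.State := if h : ∃ U, State.Step T U then h.choose else T
  let τ (n : ℕ) : R.State := next^[n] R.initialState
  have hτ (n : ℕ) (h : ¬ (τ n).IsStuck) : State.Step (τ n) (τ (n + 1)) := by
    have hex : ∃ U, State.Step (τ n) U := not_forall_not.1 h
    have hsucc : τ (n + 1) = next (τ n) := Function.iterate_succ_apply' _ _ _
    rw [hsucc]
    simp only [next, dif_pos hex]
    exact hex.choose_spec
  by_cases h : ∃ n, (τ n).IsStuck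
  · refine ⟨Nat.find h, τ, rfl, fun n hn => hτ n (Nat.find_min h (Nat.cast_lt.1 hn)), ?_⟩
    intro n hn
    exact Nat.cast_injective hn ▸ Nat.find_spec h
  · exact ⟨⊤, τ, rfl, fun n _ => hτ n (not_exists.1 h n), fun n hn => absurd hn (by simp)⟩

namespace IsRun

theorem coherent (h : R.IsRun N τ) (hn : n ≤ N) : (τ n).Coherent := by
  induction n with
  | zero => exact h.start ▸ State.coherent_initialState
  | succ n ih =>
    have hlt : (n : ℕ∞) < N := lt_of_lt_of_le (Nat.cast_lt.2 n.lt_succ_self) hn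
    exact (ih hlt.le).step (h.step n hlt)

variable [Finite E]

theorem le_ncard_visited (h : R.IsRun N τ) (hn : n ≤ N) : n ≤ (τ n).visited.ncard := by
  induction n with
  | zero => exact Nat.zero_le _
  | succ n ih =>
    have hlt : (n : ℕ∞) < N := lt_of_lt_of_le (Nat.cast_lt.2 n.lt_succ_self) hn
    exact (ih hlt.le).trans_lt (Set.ncard_lt_ncard ((h.coherent hlt.le).visited_ssubset
      (h.step n hlt)) (R.finite_stations.subset (τ (n + 1)).visited_subset_stations))

theorem le_ncard_stations (h : R.IsRun N τ) (hn : n ≤ N) : n ≤ R.stations.ncard :=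
  (h.le_ncard_visited hn).trans
    (Set.ncard_le_ncard (τ n).visited_subset_stations R.finite_stations)

theorem exists_coherent_isStuck (h : R.IsRun N τ) :
    ∃ n : ℕ, N = n ∧ (τ n).Coherent ∧ (τ n).IsStuck := by
  have hN : N ≠ ⊤ := by
    rintro rfl
    exact (h.le_ncard_stations (n := R.stations.ncard + 1) le_top).not_gt (Nat.lt_succ_self _)
  lift N to ℕ using hN
  exact ⟨N, rfl, h.coherent le_rfl, h.maximal N rfl⟩

end IsRun

end Structure

end SMLL

theorem mainTheorem6 {L E : Type} [Finite L] [Finite E] (R : SMLL.Structure L E) (hR : R.IsNet) :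
    ∃! F : R.State, F.IsFinal ∧
      ∀ (N : ℕ∞) (τ : ℕ → R.State), R.IsRun N τ → ∃ n : ℕ, N = n ∧ τ n = F := by
  obtain ⟨N, τ, h⟩ := R.exists_isRun
  obtain ⟨n, rfl, hT, hS⟩ := h.exists_coherent_isStuck
  refine ⟨τ n, ⟨hT.isFinal hS hR, fun N' τ' h' => ?_⟩, ?_⟩
  · obtain ⟨n', rfl, hT', hS'⟩ := h'.exists_coherent_isStuck
    exact ⟨n', rfl, hT'.eq_of_isStuck hS' hT hS hR⟩
  · rintro F ⟨-, hF⟩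
    obtain ⟨n', hn, rfl⟩ := hF _ τ h
    rw [Nat.cast_injective hn]
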